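/- For $n\ge 1$ and $p,s\in[0,1]$, let $\mathcal G(n,p;s)$ be the following law of $(G_1,G_2,\pi^*)$: $G_0$ is an Erdős–Rényi graph $\mathcal G(n,p)$ on $[n]$; given $G_0$, the graphs $G_1^*$ and $G_2$ are obtained from $G_0$ by two independent subsamplings, each keeping every edge independently with probability $s$; $\pi^*$ is a uniform permutation of $[n]$ independent of these graphs; and $G_1$ is $G_1^*$ with every vertex $i$ relabelled as $\pi^*(i)$. In the seeded model $\mathcal G(n,p;s,\alpha)$ one is also given $\pi_0:[n]\to[n]\cup\{?\}$ such that, independently for different $i$ and of everything else, $\pi_0(i)=\pi^*(i)$ with probability $\alpha$ and $\pi_0(i)={?}$ with probability $1-\alpha$. A seeded graph matching algorithm $\mathcal A$ is a (possibly randomized) map which to every input $(G_1,G_2,\pi_0)$, with arbitrary $\pi_0:[n]\to[n]\cup\{?\}$, assigns a permutation of $[n]$. "With high probability" means with probability tending to $1$ as $n\to\infty$. Given such an $\mathcal A$ and $\alpha\in[0,1]$, the seedless algorithm $\mathcal B$ does the following on input $(G_1,G_2)$. (1) It selects a random subset $I_0\subseteq[n]$ by including each vertex independently with probability $\alpha$.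 (2) For each of the mappings $f:I_0\to[n]$, it calls $\mathcal A$ once (with fresh randomness) on $(G_1,G_2,\pi_0)$, where $\pi_0=f$ on $I_0$ and $\pi_0={?}$ off $I_0$; let $\pi_f$ be the answer. (3) It outputs a permutation $\hat\pi\in\arg\min_{\pi_f}\|G_1-\Pi_fG_2\Pi_f^\top\|_F^2$, where the graphs are identified with their adjacency matrices, $\Pi_f$ is the permutation matrix with $(\Pi_f)_{\pi_f(i),i}=1$, and ties are broken by an arbitrary rule. Theorem. There is an absolute constant $C>0$ such that the following holds. Let $p=p_n$, $s=s_n$, $\alpha=\alpha_n$ be sequences in $[0,1]$ such that $s=\Theta(1)$, $p$ is bounded away from $1$ (that is, $p_n\le p_1$ for all large $n$, with some constant $p_1<1$), $$nps^2-\log n\to+\infty\quad\text{and}\quad \alpha n\to+\infty .$$ Suppose that a seeded graph matching algorithm $\mathcal A$ outputs $\pi^*$ with high probability under the seeded model $\mathcal G(n,p;s,\alpha)$. Then, under the seedless model $\mathcal G(n,p;s)$, with high probability the algorithm $\mathcal B$ outputs $\hat\pi=\pi^*$ and calls $\mathcal A$ at most $n^{C\alpha n}$ times. -/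

import Mathlib

open Filter Topology
open scoped unitInterval ENNReal

noncomputable section

namespace GraphMatching

/-! ## The random graph models -/

instance instMeasurableSingletonClassSimpleGraph (n : ℕ) :
    MeasurableSingletonClass (SimpleGraph (Fin n)) where
  measurableSet_singleton G := by
    have h : ({G} : Set (SimpleGraph (Fin n))) = SimpleGraph.edgeSet ⁻¹' {G.edgeSet} := by
      ext H
      simp
    rw [h]
    exact SimpleGraph.measurable_edgeSet (measurableSet_singleton _)

/-- Subsampling: keep every edge of `G` independently with probability `s`. -/
def subsample {n : ℕ} (s : I) (G : SimpleGraph (Fin n)) : PMF (SimpleGraph (Fin n)) :=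
  (ProbabilityTheory.setBernoulli G.edgeSet s).toPMF.map SimpleGraph.fromEdgeSet

/-- A random subset of `[n]` containing every element independently with probability `α`. -/
def randomSubset (n : ℕ) (α : I) : PMF (Set (Fin n)) :=
  (ProbabilityTheory.setBernoulli (Set.univ : Set (Fin n)) α).toPMF

/-- The joint law of `(G₁, G₂, π*)` under the correlated Erdős–Rényi model `𝒢(n, p; s)`:
`G₀ ∼ 𝒢(n, p)`; given `G₀`, the graphs `G₁*` and `G₂` are two independent subsamples of `G₀`;
`π*` is an independent uniform permutation; and `G₁` is `G₁*` with every vertex `i` relabelled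
as `π* i`. -/
def correlatedER (n : ℕ) (p s : I) :
    PMF (SimpleGraph (Fin n) × SimpleGraph (Fin n) × Equiv.Perm (Fin n)) :=
  (SimpleGraph.binomialRandom (Fin n) p).toPMF.bind fun G₀ =>
  (subsample s G₀).bind fun G₁' =>
  (subsample s G₀).bind fun G₂ =>
  (PMF.uniformOfFintype (Equiv.Perm (Fin n))).bind fun π =>
  PMF.pure (G₁'.map π, G₂, π)

/-- The input of a seeded graph matching algorithm: two graphs `G₁`, `G₂` and a seed map
`π₀ : [n] → [n] ∪ {?}`, where `none` stands for `?`. -/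
abbrev SeededInput (n : ℕ) : Type :=
  SimpleGraph (Fin n) × SimpleGraph (Fin n) × (Fin n → Option (Fin n))

open Classical in
/-- The seed map with seed set `S` and values `f` on `S`. -/
def seedMap {n : ℕ} (S : Set (Fin n)) (f : S → Fin n) : Fin n → Option (Fin n) :=
  fun i => if h : i ∈ S then some (f ⟨i, h⟩) else none

/-- The joint law of `((G₁, G₂, π₀), π*)` under the seeded model `𝒢(n, p; s, α)`: every vertex is
a seed, that is `π₀ i = π* i`, independently with probability `α`, and `π₀ i = ?` otherwise. -/
def seededModel (n : ℕ) (p s α : I) : PMF (SeededInput n × Equiv.Perm (Fin n)) :=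
  (correlatedER n p s).bind fun x =>
  (randomSubset n α).bind fun S =>
  PMF.pure ((x.1, x.2.1, seedMap S fun i => x.2.2 i), x.2.2)

/-- A (possibly randomized) seeded graph matching algorithm on `n` vertices: on each input, the
law of the permutation that it outputs. -/
abbrev SeededAlg (n : ℕ) : Type :=
  SeededInput n → PMF (Equiv.Perm (Fin n))

/-- The probability that the algorithm `A` outputs `π*` under the seeded model
`𝒢(n, p; s, α)`. -/
def seededSuccess (n : ℕ) (p s α : I) (A : SeededAlg n) : ℝ≥0∞ :=
  ((seededModel n p s α).bind fun x => (A x.1).map fun π => (π, x.2)).toOuterMeasure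
    {y | y.1 = y.2}

/-! ## Randomized programs that call a subroutine -/

/-- Randomized programs with results in `A` that may call a subroutine, which takes queries in `Q`
and answers in `R`. -/
inductive OracleProgram (Q R A : Type) : Type 1 where
  /-- stop with a result -/
  | ret (a : A) : OracleProgram Q R A
  /-- draw a random element with law `μ` and go on with it -/
  | sample {B : Type} (μ : PMF B) (k : B → OracleProgram Q R A) : OracleProgram Q R A
  /-- call the subroutine on `q` and go on with its answer -/
  | call (q : Q) (k : R → OracleProgram Q R A) : OracleProgram Q R A

/-- The joint law of the result and of the number of calls of the subroutine, when every call on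
`q` is answered, with fresh randomness, according to the law `O q`. -/
def OracleProgram.run {Q R A : Type} (O : Q → PMF R) : OracleProgram Q R A → PMF (A × ℕ)
  | .ret a => PMF.pure (a, 0)
  | .sample μ k => μ.bind fun b => (k b).run O
  | .call q k => (O q).bind fun r => ((k r).run O).map fun x => (x.1, x.2 + 1)

/-- Call the subroutine once on each query of the list, in order, and go on with the list of
answers. -/
def OracleProgram.callAll {Q R A : Type} :
    List Q → (List R → OracleProgram Q R A) → OracleProgram Q R A
  | [], k => k []
  | q :: qs, k => .call q fun r => callAll qs fun rs => k (r :: rs)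

/-! ## Seedless graph matching via seeded graph matching -/

open Classical in
/-- The adjacency matrix of a graph. -/
def adj {n : ℕ} (G : SimpleGraph (Fin n)) : Matrix (Fin n) (Fin n) ℝ :=
  G.adjMatrix ℝ

/-- The permutation matrix `Π` of `π`, with `Π (π i) i = 1`, so that
`(Π * G * Πᵀ) (π i) (π j) = G i j`. -/
def permMat {n : ℕ} (π : Equiv.Perm (Fin n)) : Matrix (Fin n) (Fin n) ℝ :=
  Matrix.of fun a i => if a = π i then 1 else 0

/-- The squared Frobenius norm `∑ i j, (M i j) ^ 2`. -/
def frobeniusSq {n : ℕ} (M : Matrix (Fin n) (Fin n) ℝ) : ℝ :=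
  ∑ i, ∑ j, M i j ^ 2

/-- The objective `‖G₁ - Π G₂ Πᵀ‖_F²` of the quadratic assignment problem. -/
def qapCost {n : ℕ} (G₁ G₂ : SimpleGraph (Fin n)) (π : Equiv.Perm (Fin n)) : ℝ :=
  frobeniusSq (adj G₁ - permMat π * adj G₂ * (permMat π).transpose)

open Classical in
/-- The set of minimizers of `c` over the finite set `S`. -/
def argminSet {β : Type} (c : β → ℝ) (S : Finset β) : Finset β :=
  S.filter fun a => ∀ b ∈ S, c a ≤ c b

open Classical in
/-- The seedless matching algorithm on input `(G₁, G₂)`. It draws `S ⊆ [n]`, each vertex being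
included independently with probability `α`, calls the seeded algorithm once for each of the
mappings `f : S → [n]`, and outputs an element `π_f` of least cost `‖G₁ - Π_f G₂ Π_fᵀ‖_F²` among
the answers; `tie` picks an element of the set of all minimizers. -/
def seedlessMatching {n : ℕ} (α : I)
    (tie : SimpleGraph (Fin n) → SimpleGraph (Fin n) →
      Finset (Equiv.Perm (Fin n)) → Equiv.Perm (Fin n))
    (G₁ G₂ : SimpleGraph (Fin n)) :
    OracleProgram (SeededInput n) (Equiv.Perm (Fin n)) (Equiv.Perm (Fin n)) :=
  .sample (randomSubset n α) fun S =>
  .callAll ((Finset.univ : Finset (S → Fin n)).toList.map fun f => (G₁, G₂, seedMap S f))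
    fun answers => .ret (tie G₁ G₂ (argminSet (qapCost G₁ G₂) answers.toFinset))

/-- The joint law, under the seedless model `𝒢(n, p; s)`, of `(π̂, N, π*)`, where `π̂` is the
output of the seedless matching algorithm run with the seeded algorithm `A`, and `N` is the number
of its calls of `A`. -/
def seedlessRun (n : ℕ) (p s α : I) (A : SeededAlg n)
    (tie : SimpleGraph (Fin n) → SimpleGraph (Fin n) →
      Finset (Equiv.Perm (Fin n)) → Equiv.Perm (Fin n)) :
    PMF (Equiv.Perm (Fin n) × ℕ × Equiv.Perm (Fin n)) :=
  (correlatedER n p s).bind fun x =>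
  ((seedlessMatching α tie x.1 x.2.1).run A).map fun y => (y.1, y.2, x.2.2)

end GraphMatching

end

/-! Among the mappings tried by the seedless algorithm is the restriction of `π*` to the random set.
That call has the same input law as the seeded model, so it returns `π*` with high probability. Two
things remain: `π*` must win the final comparison, and the number of calls must be small. If `π*` is
the unique minimizer of the quadratic assignment cost over all permutations, it wins whatever the
other answers are. The number of calls is `n ^ |S|`, and `|S|` is binomial with mean `αn → ∞`, so it
rarely exceeds `2αn`. `seededSuccess_le` combines these facts into one inequality.

The substance is uniqueness of the minimizer. The cost is a constant minus a multiple of an edge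
overlap (`qapCost_map`), so a failure gives some `τ ≠ 1` whose overlap is at least that of the
identity. For fixed `τ`, a moment generating function factorizes along the cycles of `τ` on pairs.
Each cycle gives the trace of a power of a two-by-two matrix. Cycles of moved pairs have length at
least 2, so Hilbert–Schmidt norms bound the whole product (`sum_sum_prod_mul_le`). Tilting by `√p`
gives `prob_overlap_one_le`, whose rate per moved pair is asymptotic to `ps²` as `p → 0`, provided
`s` stays away from 0.

At most `n ^ k` permutations move exactly `k` vertices. If `nps²` exceeds a large multiple of `log
n`, a crude count of moved pairs suffices (`prob_confusable_le_of_dense`). Near the threshold the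
union bound is sharp only for `k ≤ n / log n`, where about `kn` pairs are moved. In general only
about `kn / 2` can be guaranteed, which loses a factor 2. Larger supports are handled in
`prob_confusable_le_of_sparse`: a large vertex set meets many common edges, and a wrong permutation
would have to reproduce nearly as many by coincidence, which is very unlikely since `p` is then of
order at most `log n / n`. -/

namespace GraphMatching

/-! ### Lists of calls to a subroutine -/

namespace OracleProgram

variable {Q R A : Type} (O : Q → PMF R)

/-- The number of calls is deterministic, so an event that holds for every possible answer list is
certain. It disposes of the queries that follow the good one in the next lemma. -/
theorem toOuterMeasure_run_callAll_eq_one (qs : List Q) (K : List R → A) (T : Set (A × ℕ))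
    (h : ∀ rs : List R, rs.length = qs.length → (K rs, qs.length) ∈ T) :
    ((callAll qs fun rs => ret (K rs)).run O).toOuterMeasure T = 1 := by
  induction qs generalizing K T with
  | nil =>
    have := h [] rfl
    simp [callAll, run, PMF.toOuterMeasure_pure_apply] at this ⊢
    exact this
  | cons q qs ih =>
    simp only [callAll, run, PMF.toOuterMeasure_bind_apply, PMF.toOuterMeasure_map_apply]
    have : ∀ r, ((callAll qs fun rs => ret (K (r :: rs))).run O).toOuterMeasure
        ((fun x : A × ℕ => (x.1, x.2 + 1)) ⁻¹' T) = 1 := fun r =>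
      ih (fun rs => K (r :: rs)) _ fun rs hrs => by
        simpa using h (r :: rs) (by simp [hrs])
    simp [this, PMF.tsum_coe]

/-- Calling the subroutine on `q` among other queries produces the answer `r` at least as often as
a single call does. -/
theorem le_toOuterMeasure_run_callAll (qs : List Q) (K : List R → A) (T : Set (A × ℕ)) {q : Q}
    (hq : q ∈ qs) (r : R)
    (h : ∀ rs : List R, rs.length = qs.length → r ∈ rs → (K rs, qs.length) ∈ T) :
    O q r ≤ ((callAll qs fun rs => ret (K rs)).run O).toOuterMeasure T := by
  induction qs generalizing K T with
  | nil => simp at hq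
  | cons q' qs ih =>
    simp only [callAll, run, PMF.toOuterMeasure_bind_apply, PMF.toOuterMeasure_map_apply]
    rcases List.mem_cons.1 hq with rfl | hq
    · refine le_trans ?_ (ENNReal.le_tsum r)
      rw [toOuterMeasure_run_callAll_eq_one O qs (fun rs => K (r :: rs)), mul_one]
      intro rs hrs
      simpa using h (r :: rs) (by simp [hrs]) (by simp)
    · calc O q r = ∑' r', O q' r' * O q r := by
            rw [ENNReal.tsum_mul_right, PMF.tsum_coe, one_mul]
        _ ≤ _ := ENNReal.tsum_le_tsum fun r' => by
            gcongr
            refine ih (fun rs => K (r' :: rs)) _ hq fun rs hrs hr => ?_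
            simpa using h (r' :: rs) (by simp [hrs]) (by simp [hr])

end OracleProgram

/-! ### Comparison of the seeded and seedless models -/

theorem tie_argminSet_eq {β : Type} {c : β → ℝ} {S : Finset β} {b : β} {t : Finset β → β}
    (ht : ∀ S, S.Nonempty → t S ∈ S) (hb : b ∈ S) (h : ∀ b', b' ≠ b → c b < c b') :
    t (argminSet c S) = b := by
  classical
  have : argminSet c S = {b} := by
    ext x
    simp only [argminSet, Finset.mem_filter, Finset.mem_singleton]
    constructor
    · rintro ⟨_, hx⟩
      by_contra hne
      exact absurd (hx b hb) (not_le.2 (h x hne))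
    · rintro rfl
      refine ⟨hb, fun y _ => ?_⟩
      by_cases hy : y = x
      · rw [hy]
      · exact (h y hy).le
  have h2 := ht (argminSet c S) (by simp [this])
  rw [this] at h2 ⊢
  simpa using h2

/-- The event that `π` is not the only minimizer of the quadratic assignment problem. -/
def NotUniqueMin {n : ℕ} (x : SimpleGraph (Fin n) × SimpleGraph (Fin n) × Equiv.Perm (Fin n)) :
    Prop :=
  ∃ π, π ≠ x.2.2 ∧ qapCost x.1 x.2.1 π ≤ qapCost x.1 x.2.1 x.2.2

theorem seededSuccess_eq (n : ℕ) (p s α : I) (A : SeededAlg n) :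
    seededSuccess n p s α A = ∑' x, correlatedER n p s x * ∑' S, randomSubset n α S *
      A (x.1, x.2.1, seedMap S fun i => x.2.2 i) x.2.2 := by
  simp only [seededSuccess, seededModel, PMF.bind_bind, PMF.toOuterMeasure_bind_apply,
    PMF.pure_bind, PMF.toOuterMeasure_map_apply]
  congr! 5 with x S
  rw [← PMF.toOuterMeasure_apply_singleton (A _)]
  rfl

open Classical in
theorem seedlessRun_eq (n : ℕ) (p s α : I) (A : SeededAlg n)
    (tie : SimpleGraph (Fin n) → SimpleGraph (Fin n) →
      Finset (Equiv.Perm (Fin n)) → Equiv.Perm (Fin n)) (T) :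
    (seedlessRun n p s α A tie).toOuterMeasure T =
      ∑' x, correlatedER n p s x * ∑' S, randomSubset n α S *
        ((OracleProgram.callAll ((Finset.univ : Finset (S → Fin n)).toList.map
          fun f => (x.1, x.2.1, seedMap S f)) fun answers => .ret (tie x.1 x.2.1
            (argminSet (qapCost x.1 x.2.1) answers.toFinset))).run
          A).toOuterMeasure {y | (y.1, y.2, x.2.2) ∈ T} := by
  simp only [seedlessRun, seedlessMatching, PMF.toOuterMeasure_bind_apply,
    PMF.toOuterMeasure_map_apply, OracleProgram.run]
  rfl

open Classical in
-- Condition on the graphs, on `π*` and on the seed set `S`. Outside the two bad events, the query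
-- with `f = π*` on `S` belongs to the list; if its answer is `π*`, strict minimality makes `π*` the
-- output under any tie rule, and the number of calls is `n ^ |S| ≤ N`.
theorem seededSuccess_le (n : ℕ) (p s α : I) (A : SeededAlg n)
    (tie : SimpleGraph (Fin n) → SimpleGraph (Fin n) →
      Finset (Equiv.Perm (Fin n)) → Equiv.Perm (Fin n))
    (htie : ∀ G₁ G₂ S, S.Nonempty → tie G₁ G₂ S ∈ S) (N : ℝ) :
    seededSuccess n p s α A ≤
      (seedlessRun n p s α A tie).toOuterMeasure {y | y.1 = y.2.2 ∧ (y.2.1 : ℝ) ≤ N} +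
      (correlatedER n p s).toOuterMeasure {x | NotUniqueMin x} +
      (randomSubset n α).toOuterMeasure {S | N < (n : ℝ) ^ S.ncard} := by
  rw [seededSuccess_eq, seedlessRun_eq, PMF.toOuterMeasure_apply, PMF.toOuterMeasure_apply]
  have hS : ∑' S, Set.indicator {S | N < (n : ℝ) ^ S.ncard} (⇑(randomSubset n α)) S =
      ∑' x, correlatedER n p s x *
        ∑' S, Set.indicator {S | N < (n : ℝ) ^ S.ncard} (⇑(randomSubset n α)) S := by
    rw [ENNReal.tsum_mul_right, PMF.tsum_coe, one_mul]
  rw [hS, ← ENNReal.tsum_add, ← ENNReal.tsum_add]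
  refine ENNReal.tsum_le_tsum fun x => ?_
  by_cases hx : NotUniqueMin x
  · have h1 : ∑' S, randomSubset n α S *
        A (x.1, x.2.1, seedMap S fun i => x.2.2 i) x.2.2 ≤ 1 := by
      rw [← PMF.tsum_coe (randomSubset n α)]
      exact ENNReal.tsum_le_tsum fun S => mul_le_of_le_one_right' (PMF.coe_le_one _ _)
    have h2 : Set.indicator {x | NotUniqueMin x} (⇑(correlatedER n p s)) x =
        correlatedER n p s x := Set.indicator_of_mem (by exact hx) _
    rw [h2]
    calc _ ≤ correlatedER n p s x := mul_le_of_le_one_right' h1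
      _ ≤ _ := le_add_right le_add_self
  · rw [Set.indicator_of_notMem (by exact hx), add_zero, ← mul_add, ← ENNReal.tsum_add]
    gcongr with S
    by_cases hN : N < (n : ℝ) ^ S.ncard
    · rw [Set.indicator_of_mem (by exact hN)]
      exact le_add_left (mul_le_of_le_one_right' (PMF.coe_le_one _ _))
    · refine le_add_right ?_
      gcongr
      refine OracleProgram.le_toOuterMeasure_run_callAll A _ _ _ ?_ _ ?_
      · exact List.mem_map.2 ⟨_, by simp, rfl⟩
      · intro rs _ hr
        refine ⟨?_, ?_⟩
        · refine tie_argminSet_eq (htie _ _) (by simpa using hr) fun π hπ => ?_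
          by_contra hlt
          exact hx ⟨π, hπ, not_lt.1 hlt⟩
        · simp only [List.length_map, Finset.length_toList, Finset.card_univ, Fintype.card_fun,
            Fintype.card_fin, Nat.cast_pow]
          rw [← Nat.card_eq_fintype_card, Nat.card_coe_set_eq]
          exact not_lt.1 hN

/-! ### The size of the seed set -/

theorem randomSubset_apply (n : ℕ) (α : I) (S : Set (Fin n)) :
    randomSubset n α S =
      ENNReal.ofReal ((α : ℝ) ^ S.ncard * (1 - α : ℝ) ^ (n - S.ncard)) := by
  have h : ((Set.univ : Set (Fin n)) \ S).ncard = n - S.ncard := by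
    rw [Set.ncard_sdiff (Set.subset_univ _)]
    simp
  rw [randomSubset, MeasureTheory.Measure.toPMF_apply,
    ← ENNReal.ofReal_toReal (a := ProbabilityTheory.setBernoulli _ _ _)
      (MeasureTheory.measure_ne_top _ _), ← MeasureTheory.measureReal_def,
    ProbabilityTheory.setBernoulli_real_singleton _ (Set.subset_univ _) (Set.toFinite _), h]

/-- Markov's inequality for `2 ^ |S|`, whose mean is `(1 + α) ^ n` by the binomial theorem. -/
theorem toOuterMeasure_randomSubset_le (n : ℕ) (α : I) (x : ℝ) :
    (randomSubset n α).toOuterMeasure {S | x < S.ncard} ≤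
      ENNReal.ofReal ((2 : ℝ) ^ (-x) * Real.exp (α * n)) := by
  classical
  have hα := α.2.1
  have hα' : 0 ≤ 1 - (α : ℝ) := by linarith [α.2.2]
  have key : ∀ S : Set (Fin n), Set.indicator {S : Set (Fin n) | x < S.ncard} (randomSubset n α) S ≤
      ENNReal.ofReal ((2 : ℝ) ^ (-x) * ((2 * α : ℝ) ^ S.ncard * (1 - α : ℝ) ^ (n - S.ncard))) := by
    intro S
    by_cases hS : x < S.ncard
    · rw [Set.indicator_of_mem (by exact hS), randomSubset_apply]
      refine ENNReal.ofReal_le_ofReal ?_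
      have h1 : (1 : ℝ) ≤ (2 : ℝ) ^ (-x) * 2 ^ S.ncard := by
        rw [← Real.rpow_natCast, ← Real.rpow_add two_pos]
        exact Real.one_le_rpow one_le_two (by linarith)
      rw [mul_pow, mul_assoc, ← mul_assoc]
      exact le_mul_of_one_le_left (by positivity) h1
    · rw [Set.indicator_of_notMem (by exact hS)]
      exact zero_le
  rw [PMF.toOuterMeasure_apply_fintype]
  refine (Finset.sum_le_sum fun S _ => key S).trans ?_
  rw [← ENNReal.ofReal_sum_of_nonneg (fun S _ => by positivity), ← Finset.mul_sum]
  refine ENNReal.ofReal_le_ofReal ?_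
  gcongr
  have h2 : ∑ S : Set (Fin n), (2 * α : ℝ) ^ S.ncard * (1 - α : ℝ) ^ (n - S.ncard) =
      (1 + α : ℝ) ^ n := by
    rw [← Fintype.finsetEquivSet.sum_comp]
    have := Fintype.sum_pow_mul_eq_add_pow (Fin n) (2 * α : ℝ) (1 - α)
    simp only [Fintype.card_fin] at this
    simp only [Fintype.finsetEquivSet_apply, Set.ncard_coe_finset]
    rw [this]
    congr 1
    ring
  rw [h2, mul_comm, Real.exp_nat_mul]
  gcongr
  linarith [Real.add_one_le_exp (α : ℝ)]

/-- The previous bound at `x = 2αn`. The exponent is useful because `2 log 2 > 1`; this is what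
makes 2 an admissible constant `C`. -/
theorem toOuterMeasure_randomSubset_pow_le {n : ℕ} (hn : 1 ≤ n) (α : I) :
    (randomSubset n α).toOuterMeasure
        {S | (n : ℝ) ^ (2 * ((α : ℝ) * n)) < (n : ℝ) ^ S.ncard} ≤
      ENNReal.ofReal (Real.exp (-((2 * Real.log 2 - 1) * (α * n)))) := by
  have hn' : (1 : ℝ) ≤ n := by exact_mod_cast hn
  refine le_trans (MeasureTheory.measure_mono fun S hS => ?_)
    ((toOuterMeasure_randomSubset_le n α (2 * (α * n))).trans_eq ?_)
  · simp only [Set.mem_ofPred_eq] at hS ⊢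
    by_contra hle
    rw [← Real.rpow_natCast] at hS
    exact absurd hS (not_lt.2 (Real.rpow_le_rpow_of_exponent_le hn' (not_lt.1 hle)))
  · rw [Real.rpow_def_of_pos two_pos, ← Real.exp_add]
    congr 2
    ring

/-! ## Edge configurations -/

/-- The number of `e` such that `a (τ e)` and `b e` hold. -/
def overlap {F : Type*} [Fintype F] (τ : Equiv.Perm F) (a b : F → Bool) : ℕ :=
  (Finset.univ.filter fun e => a (τ e) = true ∧ b e = true).card

/-- The pairs of distinct vertices. -/
abbrev Pairs (n : ℕ) : Type := {e : Sym2 (Fin n) // ¬ e.IsDiag}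

/-- The permutation of the pairs of vertices induced by a permutation of the vertices. -/
def pairPerm {n : ℕ} (π : Equiv.Perm (Fin n)) : Equiv.Perm (Pairs n) where
  toFun e := ⟨e.1.map π, by rw [Sym2.isDiag_map π.injective]; exact e.2⟩
  invFun e := ⟨e.1.map π.symm, by rw [Sym2.isDiag_map π.symm.injective]; exact e.2⟩
  left_inv e := by ext1; simp [Sym2.map_map]
  right_inv e := by ext1; simp [Sym2.map_map]

@[simp] theorem coe_pairPerm {n : ℕ} (π : Equiv.Perm (Fin n)) (e : Pairs n) :
    (pairPerm π e : Sym2 (Fin n)) = e.1.map π := rfl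

open Classical in
/-- Graphs correspond to their edge indicator functions. -/
noncomputable def graphEquiv (n : ℕ) : SimpleGraph (Fin n) ≃ (Pairs n → Bool) where
  toFun G e := decide (e.1 ∈ G.edgeSet)
  invFun a := SimpleGraph.fromEdgeSet {e | ∃ h, a ⟨e, h⟩ = true}
  left_inv G := by
    ext i j
    simp only [SimpleGraph.fromEdgeSet_adj, Set.mem_ofPred_eq, decide_eq_true_eq,
      SimpleGraph.mem_edgeSet, Sym2.mk_isDiag_iff, exists_prop]
    exact ⟨fun h => h.1.2, fun h => ⟨⟨h.ne, h⟩, h.ne⟩⟩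
  right_inv a := by
    ext ⟨e, he⟩
    simp only [SimpleGraph.edgeSet_fromEdgeSet, Set.mem_sdiff, Set.mem_ofPred_eq]
    rw [Bool.eq_iff_iff, decide_eq_true_eq]
    exact ⟨fun h => h.1.2, fun h => ⟨⟨he, h⟩, he⟩⟩

@[simp] theorem graphEquiv_apply {n : ℕ} (G : SimpleGraph (Fin n)) (e : Pairs n) :
    graphEquiv n G e = true ↔ e.1 ∈ G.edgeSet := by
  simp [graphEquiv]

theorem sum_sum_sym2 {n : ℕ} (h : Sym2 (Fin n) → ℝ) (h0 : ∀ e, e.IsDiag → h e = 0) :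
    ∑ i, ∑ j, h s(i, j) = 2 * ∑ e : Pairs n, h e.1 := by
  classical
  have h1 : ∑ e : Pairs n, h e.1 = ∑ e : Sym2 (Fin n), h e := by
    rw [← Finset.sum_subtype (Finset.univ.filter fun e : Sym2 (Fin n) => ¬ e.IsDiag)
      (by simp) h, Finset.sum_filter]
    · refine Finset.sum_congr rfl fun e _ => ?_
      by_cases he : e.IsDiag <;> simp [he, h0]
  rw [h1, ← Fintype.sum_prod_type', ← Finset.sum_fiberwise (s := Finset.univ)
    (g := fun x : Fin n × Fin n => s(x.1, x.2)), Finset.mul_sum]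
  refine Finset.sum_congr rfl fun e _ => ?_
  rw [Finset.sum_congr rfl (g := fun _ => h e) (fun x hx => by
    rw [← (Finset.mem_filter.1 hx).2]), Finset.sum_const, nsmul_eq_mul]
  by_cases he : e.IsDiag
  · simp [h0 e he]
  · congr 1
    induction e using Sym2.ind with
    | _ x y =>
    have hxy : x ≠ y := by simpa using he
    have : Finset.univ.filter (fun z : Fin n × Fin n => s(z.1, z.2) = s(x, y)) =
        {(x, y), (y, x)} := by
      ext ⟨u, v⟩
      simp
    rw [this, Finset.card_pair (by simp [hxy])]
    norm_num

theorem qapCost_eq_sum {n : ℕ} (G₁ G₂ : SimpleGraph (Fin n)) (π : Equiv.Perm (Fin n)) :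
    qapCost G₁ G₂ π = ∑ i, ∑ j, (adj G₁ (π i) (π j) - adj G₂ i j) ^ 2 := by
  have h : ∀ i j, (permMat π * adj G₂ * (permMat π).transpose) i j =
      adj G₂ (π.symm i) (π.symm j) := by
    intro i j
    have h1 : ∀ a i, permMat π a i = if i = π.symm a then 1 else 0 := by
      intro a i
      simp only [permMat, Matrix.of_apply, Equiv.eq_symm_apply, eq_comm]
    simp [Matrix.mul_apply, Matrix.transpose_apply, h1]
  unfold qapCost frobeniusSq
  simp only [Matrix.sub_apply, h]
  rw [← Equiv.sum_comp π]
  refine Finset.sum_congr rfl fun i _ => ?_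
  rw [← Equiv.sum_comp π]
  simp

/-- Expanding the square on indicators leaves the two edge counts, which do not depend on `π'`, and
the cross term. Minimizing the cost therefore means maximizing the overlap, and only the relative
permutation `π⁻¹ * π'` matters. -/
theorem qapCost_map {n : ℕ} (A B : SimpleGraph (Fin n)) (π π' : Equiv.Perm (Fin n)) :
    qapCost (A.map π) B π' = 2 * (((Finset.univ.filter fun e => graphEquiv n A e = true).card : ℝ) +
      (Finset.univ.filter fun e => graphEquiv n B e = true).card -
      2 * overlap (pairPerm (π⁻¹ * π')) (graphEquiv n A) (graphEquiv n B)) := by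
  classical
  set τ := π⁻¹ * π' with hτ
  let h : Sym2 (Fin n) → ℝ := fun e =>
    ((if e.map τ ∈ A.edgeSet then 1 else 0) - (if e ∈ B.edgeSet then 1 else 0)) ^ 2
  have h1 : qapCost (A.map π) B π' = ∑ i, ∑ j, h s(i, j) := by
    rw [qapCost_eq_sum]
    refine Finset.sum_congr rfl fun i _ => Finset.sum_congr rfl fun j _ => ?_
    have : (A.map π).Adj (π' i) (π' j) ↔ A.Adj (τ i) (τ j) := by
      have h2 : ∀ i, π' i = π (τ i) := by intro i; simp [hτ]
      rw [h2, h2]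
      exact SimpleGraph.map_adj_apply (f := π.toEmbedding)
    simp [h, adj, SimpleGraph.adjMatrix_apply, this]
  rw [h1, sum_sum_sym2 h]
  · congr 1
    have h3 : ((Finset.univ.filter fun e => graphEquiv n A e = true).card : ℝ) =
        ∑ e : Pairs n, if (pairPerm τ e).1 ∈ A.edgeSet then (1 : ℝ) else 0 := by
      rw [Equiv.sum_comp (pairPerm τ) (fun e : Pairs n => if e.1 ∈ A.edgeSet then (1 : ℝ) else 0),
        Finset.sum_boole]
      simp
    have h4 : ((Finset.univ.filter fun e => graphEquiv n B e = true).card : ℝ) =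
        ∑ e : Pairs n, if e.1 ∈ B.edgeSet then (1 : ℝ) else 0 := by
      rw [Finset.sum_boole]
      simp
    have h5 : (overlap (pairPerm τ) (graphEquiv n A) (graphEquiv n B) : ℝ) =
        ∑ e : Pairs n, if (pairPerm τ e).1 ∈ A.edgeSet ∧ e.1 ∈ B.edgeSet then (1 : ℝ) else 0 := by
      rw [Finset.sum_boole, overlap]
      simp only [graphEquiv_apply]
    rw [h3, h4, h5, ← Finset.sum_add_distrib, Finset.mul_sum, ← Finset.sum_sub_distrib]
    refine Finset.sum_congr rfl fun e _ => ?_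
    simp only [h, coe_pairPerm]
    (split_ifs <;> simp_all); norm_num
  · intro e he
    have h6 : e.map τ ∉ A.edgeSet := fun h => A.not_isDiag_of_mem_edgeSet h
      ((Sym2.isDiag_map τ.injective).2 he)
    have h7 : e ∉ B.edgeSet := fun h => B.not_isDiag_of_mem_edgeSet h he
    simp [h, h6, h7]

/-- Some nontrivial permutation of the vertices achieves at least the overlap of the identity. -/
def Confusable {n : ℕ} (a b : Pairs n → Bool) : Prop :=
  ∃ τ : Equiv.Perm (Fin n), τ ≠ 1 ∧ overlap 1 a b ≤ overlap (pairPerm τ) a b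

@[simp] theorem pairPerm_one {n : ℕ} : pairPerm (1 : Equiv.Perm (Fin n)) = 1 := by
  ext e
  simp

theorem Confusable.of_notUniqueMin {n : ℕ} {A B : SimpleGraph (Fin n)} {π : Equiv.Perm (Fin n)}
    (h : NotUniqueMin (A.map π, B, π)) : Confusable (graphEquiv n A) (graphEquiv n B) := by
  obtain ⟨π', hne, hle⟩ := h
  refine ⟨π⁻¹ * π', ?_, ?_⟩
  · intro h
    exact hne (inv_mul_eq_one.1 h).symm
  · dsimp only at hle
    rw [qapCost_map, qapCost_map, inv_mul_cancel, pairPerm_one] at hle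
    have : (overlap 1 (graphEquiv n A) (graphEquiv n B) : ℝ) ≤
      overlap (pairPerm (π⁻¹ * π')) (graphEquiv n A) (graphEquiv n B) := by linarith
    exact_mod_cast this

/-! ## The joint law of the two subsamples -/

/-- The probability that an edge of the base graph is present (`true`) or absent (`false`). -/
def edgeWeight (p : ℝ) : Bool → ℝ
  | true => p
  | false => 1 - p

/-- The probability that an edge with state `z` in the base graph has state `x` after
subsampling. -/
def keepWeight (s : ℝ) : Bool → Bool → ℝ
  | true, true => s
  | true, false => 1 - s
  | false, true => 0
  | false, false => 1

/-- The joint law of the states of an edge in the two subsamples. -/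
def pairWeight (p s : ℝ) (x y : Bool) : ℝ :=
  ∑ z, edgeWeight p z * keepWeight s z x * keepWeight s z y

theorem edgeWeight_nonneg (p : I) (z : Bool) : 0 ≤ edgeWeight p z := by
  cases z <;> simp [edgeWeight, p.2.1, p.2.2]

theorem keepWeight_nonneg (s : I) (z x : Bool) : 0 ≤ keepWeight s z x := by
  cases z <;> cases x <;> simp [keepWeight, s.2.1, s.2.2]

theorem pairWeight_nonneg (p s : I) (x y : Bool) : 0 ≤ pairWeight p s x y :=
  Finset.sum_nonneg fun _ _ => mul_nonneg
    (mul_nonneg (edgeWeight_nonneg _ _) (keepWeight_nonneg _ _ _)) (keepWeight_nonneg _ _ _)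

theorem card_filter_pairs_mem {n : ℕ} {T : Set (Sym2 (Fin n))} (hT : ∀ e ∈ T, ¬ e.IsDiag)
    [DecidablePred fun e : Pairs n => e.1 ∈ T] :
    (Finset.univ.filter fun e : Pairs n => e.1 ∈ T).card = T.ncard := by
  classical
  rw [← Set.ncard_coe_finset, ← Set.ncard_image_of_injective _ Subtype.val_injective]
  congr 1
  ext e
  simp only [Finset.coe_filter, Finset.mem_univ, true_and, Set.mem_image, Set.mem_ofPred_eq]
  exact ⟨by rintro ⟨e, he, rfl⟩; exact he, fun he => ⟨⟨e, hT e he⟩, he, rfl⟩⟩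

open Classical in
-- A product over all pairs, instead of powers of cardinalities, lets the base graph be summed out
-- edge by edge later. Pairs outside `U` contribute the factor 1.
theorem setBernoulli_singleton_eq_prod {n : ℕ} (s : I) {U T : Set (Sym2 (Fin n))}
    (hTU : T ⊆ U) (hU : ∀ e ∈ U, ¬ e.IsDiag) :
    ProbabilityTheory.setBernoulli U s {T} = ENNReal.ofReal
      (∏ e : Pairs n, keepWeight s (decide (e.1 ∈ U)) (decide (e.1 ∈ T))) := by
  have h : ∏ e : Pairs n, keepWeight s (decide (e.1 ∈ U)) (decide (e.1 ∈ T)) =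
      (s : ℝ) ^ T.ncard * (1 - s : ℝ) ^ (U \ T).ncard := by
    rw [← card_filter_pairs_mem fun e he => hU e (hTU he),
      ← card_filter_pairs_mem (T := U \ T) fun e he => hU e he.1, ← Finset.prod_const,
      ← Finset.prod_const, Finset.prod_filter, Finset.prod_filter, ← Finset.prod_mul_distrib]
    refine Finset.prod_congr rfl fun e _ => ?_
    by_cases h1 : e.1 ∈ T
    · simp [h1, hTU h1, keepWeight]
    · by_cases h2 : e.1 ∈ U <;> simp [h1, h2, keepWeight]
  rw [h, ← ProbabilityTheory.setBernoulli_real_singleton s hTU (Set.toFinite _),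
    MeasureTheory.measureReal_def, ENNReal.ofReal_toReal (MeasureTheory.measure_ne_top _ _)]

theorem binomialRandom_apply_eq_prod {n : ℕ} (p : I) (G : SimpleGraph (Fin n)) :
    (SimpleGraph.binomialRandom (Fin n) p).toPMF G =
      ENNReal.ofReal (∏ e, edgeWeight p (graphEquiv n G e)) := by
  classical
  rw [MeasureTheory.Measure.toPMF_apply, SimpleGraph.binomialRandom_apply', Set.image_singleton,
    setBernoulli_singleton_eq_prod p (by simp) (by simp)]
  congr 1
  refine Finset.prod_congr rfl fun e _ => ?_
  have h1 : e.1 ∈ (Sym2.diagSetᶜ : Set (Sym2 (Fin n))) := by simpa using e.2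
  have h2 : graphEquiv n G e = decide (e.1 ∈ G.edgeSet) := by simp [graphEquiv]
  rw [h2]
  by_cases h : e.1 ∈ G.edgeSet
  · simp only [h1, h, decide_true, keepWeight, edgeWeight]
  · simp only [h1, h, decide_true, decide_false, keepWeight, edgeWeight]

theorem subsample_apply_eq_prod {n : ℕ} (s : I) (G A : SimpleGraph (Fin n)) :
    subsample s G A =
      ENNReal.ofReal (∏ e, keepWeight s (graphEquiv n G e) (graphEquiv n A e)) := by
  classical
  have hG : ∀ G : SimpleGraph (Fin n), ∀ e : Pairs n,
      graphEquiv n G e = decide (e.1 ∈ G.edgeSet) := fun G e => by simp [graphEquiv]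
  rw [subsample, PMF.map_apply, tsum_eq_single A.edgeSet, if_pos (by simp),
    MeasureTheory.Measure.toPMF_apply]
  · by_cases h : A.edgeSet ⊆ G.edgeSet
    · rw [setBernoulli_singleton_eq_prod s h fun e => G.not_isDiag_of_mem_edgeSet]
      congr! 3 with e <;> simp [graphEquiv]
    · rw [ProbabilityTheory.setBernoulli_singleton_of_not_subset s h]
      obtain ⟨e, heA, heG⟩ := Set.not_subset.1 h
      rw [Finset.prod_eq_zero (Finset.mem_univ (⟨e, A.not_isDiag_of_mem_edgeSet heA⟩ : Pairs n))]
      · simp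
      · simp only [hG, heA, heG, decide_true, decide_false, keepWeight]
  · intro S hS
    split_ifs with hAS
    · rw [MeasureTheory.Measure.toPMF_apply]
      refine ProbabilityTheory.setBernoulli_singleton_of_not_subset s fun hSG => hS ?_
      rw [hAS, SimpleGraph.edgeSet_fromEdgeSet]
      refine (sdiff_eq_left.2 (Set.disjoint_left.2 fun e he hd => ?_)).symm
      exact G.not_isDiag_of_mem_edgeSet (hSG he) hd
    · rfl

/-- The probability of an event about a pair of configurations whose coordinates are independent
with law `ρ`. -/
noncomputable def prob {F : Type*} [Fintype F] [DecidableEq F] (ρ : Bool → Bool → ℝ)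
    (Q : (F → Bool) → (F → Bool) → Prop) : ℝ :=
  by classical exact ∑ a : F → Bool, ∑ b : F → Bool, if Q a b then ∏ e, ρ (a e) (b e) else 0

/-- After relabelling relative to `π*` the bad event depends only on the two subsamples, so the
uniform permutation drops out. Summing the product weights over the base graph factorizes into
`pairWeight`. -/
theorem correlatedER_notUniqueMin_le (n : ℕ) (p s : I) :
    (correlatedER n p s).toOuterMeasure {x | NotUniqueMin x} ≤
      ENNReal.ofReal (prob (pairWeight p s) (Confusable (n := n))) := by
  classical
  have hπ : ∀ A B : SimpleGraph (Fin n),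
      ((PMF.uniformOfFintype (Equiv.Perm (Fin n))).bind fun π =>
        PMF.pure (A.map π, B, π)).toOuterMeasure {x | NotUniqueMin x} ≤
      if Confusable (graphEquiv n A) (graphEquiv n B) then 1 else 0 := by
    intro A B
    split_ifs with h
    · exact (MeasureTheory.measure_mono (Set.subset_univ _)).trans_eq
        ((PMF.toOuterMeasure_apply_eq_one_iff _ _).2 (Set.subset_univ _))
    · rw [PMF.toOuterMeasure_bind_apply]
      refine le_of_eq (ENNReal.tsum_eq_zero.2 fun π => ?_)
      rw [PMF.toOuterMeasure_pure_apply, if_neg, mul_zero]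
      exact fun hx => h (Confusable.of_notUniqueMin hx)
  rw [correlatedER, PMF.toOuterMeasure_bind_apply]
  calc _ ≤ ∑ G₀ : SimpleGraph (Fin n), ∑ A : SimpleGraph (Fin n), ∑ B : SimpleGraph (Fin n),
        ENNReal.ofReal (if Confusable (graphEquiv n A) (graphEquiv n B) then
          ∏ e, (edgeWeight p (graphEquiv n G₀ e) *
            keepWeight s (graphEquiv n G₀ e) (graphEquiv n A e) *
            keepWeight s (graphEquiv n G₀ e) (graphEquiv n B e)) else 0) := by
        rw [tsum_fintype]
        refine Finset.sum_le_sum fun G₀ _ => ?_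
        rw [PMF.toOuterMeasure_bind_apply, tsum_fintype, Finset.mul_sum]
        refine Finset.sum_le_sum fun A _ => ?_
        rw [PMF.toOuterMeasure_bind_apply, tsum_fintype, Finset.mul_sum, Finset.mul_sum]
        refine Finset.sum_le_sum fun B _ => ?_
        refine (mul_le_mul_right (mul_le_mul_right (mul_le_mul_right (hπ A B) _) _) _).trans ?_
        rw [binomialRandom_apply_eq_prod, subsample_apply_eq_prod, subsample_apply_eq_prod]
        split_ifs with h
        · rw [mul_one, Finset.prod_mul_distrib, Finset.prod_mul_distrib, ENNReal.ofReal_mul,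
            ENNReal.ofReal_mul, mul_assoc]
          · exact Finset.prod_nonneg fun _ _ => edgeWeight_nonneg _ _
          · exact mul_nonneg (Finset.prod_nonneg fun _ _ => edgeWeight_nonneg _ _)
              (Finset.prod_nonneg fun _ _ => keepWeight_nonneg _ _ _)
        · simp
    _ = ENNReal.ofReal (∑ A : SimpleGraph (Fin n), ∑ B : SimpleGraph (Fin n),
        if Confusable (graphEquiv n A) (graphEquiv n B) then
          ∏ e, pairWeight p s (graphEquiv n A e) (graphEquiv n B e) else 0) := by
        have hnn : ∀ G₀ A B : SimpleGraph (Fin n), 0 ≤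
          (if Confusable (graphEquiv n A) (graphEquiv n B) then
          ∏ e, (edgeWeight p (graphEquiv n G₀ e) *
            keepWeight s (graphEquiv n G₀ e) (graphEquiv n A e) *
            keepWeight s (graphEquiv n G₀ e) (graphEquiv n B e)) else 0) := by
          intro G₀ A B
          split_ifs
          · exact Finset.prod_nonneg fun _ _ => mul_nonneg
              (mul_nonneg (edgeWeight_nonneg _ _) (keepWeight_nonneg _ _ _))
              (keepWeight_nonneg _ _ _)
          · exact le_rfl
        simp_rw [← ENNReal.ofReal_sum_of_nonneg (fun B _ => hnn _ _ B)]
        simp_rw [← ENNReal.ofReal_sum_of_nonneg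
          (fun A _ => Finset.sum_nonneg fun B _ => hnn _ A B)]
        rw [← ENNReal.ofReal_sum_of_nonneg (fun G₀ _ => Finset.sum_nonneg fun A _ =>
          Finset.sum_nonneg fun B _ => hnn G₀ A B)]
        congr 1
        rw [Finset.sum_comm]
        refine Finset.sum_congr rfl fun A _ => ?_
        rw [Finset.sum_comm]
        refine Finset.sum_congr rfl fun B _ => ?_
        split_ifs
        · rw [(graphEquiv n).sum_comp (fun c => ∏ e, (edgeWeight p (c e) *
            keepWeight s (c e) (graphEquiv n A e) * keepWeight s (c e) (graphEquiv n B e)))]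
          simp only [pairWeight]
          rw [Finset.prod_univ_sum, Fintype.piFinset_univ]
        · simp
    _ = _ := by
        rw [prob, (graphEquiv n).sum_comp (fun a => ∑ B : SimpleGraph (Fin n),
          if Confusable a (graphEquiv n B) then
            ∏ e, pairWeight p s (a e) (graphEquiv n B e) else 0)]
        congr 1
        refine Finset.sum_congr rfl fun a _ => ?_
        rw [(graphEquiv n).sum_comp (fun b => if Confusable a b then
            ∏ e, pairWeight p s (a e) (b e) else 0)]

/-! ## Sums over configurations twisted by a permutation -/

section CycleSums

variable {F κ : Type*} [Fintype F] [DecidableEq F] [Fintype κ] [DecidableEq κ]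

theorem exists_spectral_decomposition {K : κ → κ → ℝ} (hK : ∀ x y, K x y = K y x) :
    ∃ (U : κ → κ → ℝ) (l : κ → ℝ), (∀ x y, K x y = ∑ j, l j * (U x j * U y j)) ∧
      ∀ i j, ∑ x, U x i * U x j = if i = j then 1 else 0 := by
  have hH : (Matrix.of K).IsHermitian := by
    ext x y
    simp [hK x y]
  refine ⟨fun x j => hH.eigenvectorUnitary.1 x j, hH.eigenvalues, fun x y => ?_, fun i j => ?_⟩
  · have h := congrFun (congrFun hH.spectral_theorem x) y
    rw [Unitary.conjStarAlgAut_apply, Matrix.mul_apply] at h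
    simp only [Matrix.of_apply] at h
    rw [h]
    refine Finset.sum_congr rfl fun j _ => ?_
    rw [Matrix.mul_diagonal]
    simp [Matrix.star_apply]
    ring
  · have h := congrFun (congrFun (Unitary.coe_star_mul_self hH.eigenvectorUnitary) i) j
    rw [Matrix.mul_apply, Matrix.one_apply] at h
    rw [← h]
    refine Finset.sum_congr rfl fun x _ => ?_
    simp [Matrix.star_apply]

/-- The sum of a product weight over the configurations that are constant on the cycles of a
fixed point free permutation. -/
theorem sum_invariant_prod_le (τ : Equiv.Perm F) (hτ : ∀ e, τ e ≠ e) (l : κ → ℝ) :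
    ∑ J : F → κ, (if ∀ e, J (τ e) = J e then ∏ e, l (J e) else 0) ≤
      √(∑ j, l j ^ 2) ^ Fintype.card F := by
  classical
  set q := √(∑ j, l j ^ 2) with hq
  let S := Equiv.Perm.SameCycle.setoid τ
  let Φ : (Quotient S → κ) → F → κ := fun g e => g (Quotient.mk S e)
  have hΦ : Function.Injective Φ := fun g g' h => by
    ext x
    induction x using Quotient.ind with
    | _ e => exact congrFun h e
  let N : Quotient S → ℕ := fun x => (Finset.univ.filter fun e => Quotient.mk S e = x).card
  have hinv : ∀ J : F → κ, (∀ e, J (τ e) = J e) → ∀ i : ℤ, ∀ e, J ((τ ^ i) e) = J e := by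
    intro J hJ i
    induction i using Int.induction_on with
    | zero => simp
    | succ i ih =>
      intro e
      rw [zpow_add_one, Equiv.Perm.mul_apply, ih, hJ]
    | pred i ih =>
      intro e
      rw [zpow_sub_one, Equiv.Perm.mul_apply, ih, ← hJ (τ⁻¹ e)]
      simp
  have hl : ∀ j, |l j| ≤ q := fun j => Real.abs_le_sqrt
    (Finset.single_le_sum (f := fun j => l j ^ 2) (fun _ _ => sq_nonneg _) (Finset.mem_univ j))
  -- This is where the absence of fixed points enters: a cycle of length 1 would give a trace, which
  -- the Hilbert–Schmidt norm does not control this way.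
  have hN : ∀ x, 2 ≤ N x := by
    intro x
    induction x using Quotient.ind with
    | _ e =>
    refine Finset.one_lt_card.2 ⟨e, by simp, τ e, ?_, (hτ e).symm⟩
    simp only [Finset.mem_filter, Finset.mem_univ, true_and]
    exact Quotient.sound (show τ.SameCycle (τ e) e from ⟨-1, by simp⟩)
  calc _ ≤ ∑ J : F → κ, (if ∀ e, J (τ e) = J e then ∏ e, |l (J e)| else 0) := by
        refine Finset.sum_le_sum fun J _ => ?_
        split_ifs
        · rw [← Finset.abs_prod]
          exact le_abs_self _
        · exact le_rfl
    _ = ∑ J ∈ Finset.univ.filter (fun J : F → κ => ∀ e, J (τ e) = J e), ∏ e, |l (J e)| :=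
        (Finset.sum_filter _ _).symm
    _ ≤ ∑ J ∈ Finset.univ.image Φ, ∏ e, |l (J e)| := by
        refine Finset.sum_le_sum_of_subset_of_nonneg (fun J hJ => ?_)
          fun _ _ _ => Finset.prod_nonneg fun _ _ => abs_nonneg _
        have hJ' := hinv J (Finset.mem_filter.1 hJ).2
        refine Finset.mem_image.2 ⟨Quotient.lift J ?_, Finset.mem_univ _, rfl⟩
        rintro a b ⟨i, hi⟩
        rw [← hi, hJ']
    _ = ∑ g : Quotient S → κ, ∏ e, |l (g (Quotient.mk S e))| :=
        Finset.sum_image fun _ _ _ _ h => hΦ h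
    _ = ∑ g : Quotient S → κ, ∏ x, |l (g x)| ^ N x := by
        refine Finset.sum_congr rfl fun g _ => ?_
        rw [← Finset.prod_fiberwise (s := Finset.univ) (g := fun e => Quotient.mk S e)]
        refine Finset.prod_congr rfl fun x _ => ?_
        rw [Finset.prod_congr rfl (g := fun _ => |l (g x)|) (fun e he => by
          rw [← (Finset.mem_filter.1 he).2]), Finset.prod_const]
    _ = ∏ x : Quotient S, ∑ j, |l j| ^ N x := by
        rw [Finset.prod_univ_sum, Fintype.piFinset_univ]
    _ ≤ ∏ x : Quotient S, q ^ N x := by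
        refine Finset.prod_le_prod (fun _ _ => Finset.sum_nonneg fun _ _ => by positivity)
          fun x _ => ?_
        -- Two of the factors sum to `q ^ 2`; each of the others is at most `q`.
        obtain ⟨k, hk⟩ := Nat.exists_eq_add_of_le (hN x)
        rw [hk]
        calc ∑ j, |l j| ^ (2 + k) ≤ ∑ j, l j ^ 2 * q ^ k := by
              refine Finset.sum_le_sum fun j _ => ?_
              rw [pow_add, sq_abs]
              gcongr
              exact hl j
          _ = q ^ (2 + k) := by
              rw [← Finset.sum_mul, pow_add, hq, Real.sq_sqrt]
              exact Finset.sum_nonneg fun _ _ => sq_nonneg _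
    _ = q ^ Fintype.card F := by
        rw [Finset.prod_pow_eq_pow_sum, ← Finset.card_univ (α := F),
          Finset.card_eq_sum_card_fiberwise (f := fun e => Quotient.mk S e) (t := Finset.univ)
            (by simp)]

/-- Expand every `K` in an eigenbasis, with an eigenvalue index `J e` for each factor. Summing over
`a` at each coordinate, orthonormality forces neighbouring indices to agree, so only `J` constant on
cycles survive. The squared Hilbert–Schmidt norm is the sum of the squared eigenvalues. -/
theorem sum_prod_symm_le (τ : Equiv.Perm F) (hτ : ∀ e, τ e ≠ e) {K : κ → κ → ℝ}
    (hK : ∀ x y, K x y = K y x) :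
    ∑ a : F → κ, ∏ e, K (a e) (a (τ e)) ≤ √(∑ x, ∑ y, K x y ^ 2) ^ Fintype.card F := by
  obtain ⟨U, l, hKU, hU⟩ := exists_spectral_decomposition hK
  have hl : ∑ x, ∑ y, K x y ^ 2 = ∑ j, l j ^ 2 := by
    calc ∑ x, ∑ y, K x y ^ 2
        = ∑ x, ∑ y, ∑ i, ∑ j, l i * l j * ((U x i * U x j) * (U y i * U y j)) := by
          refine Finset.sum_congr rfl fun x _ => Finset.sum_congr rfl fun y _ => ?_
          rw [hKU, sq, Finset.sum_mul_sum]
          refine Finset.sum_congr rfl fun i _ => Finset.sum_congr rfl fun j _ => ?_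
          ring
      _ = ∑ i, ∑ j, l i * l j * ((∑ x, U x i * U x j) * (∑ y, U y i * U y j)) := by
          simp_rw [Finset.sum_mul_sum, Finset.mul_sum]
          rw [Finset.sum_congr rfl fun x _ => Finset.sum_comm, Finset.sum_comm]
          refine Finset.sum_congr rfl fun i _ => ?_
          rw [Finset.sum_congr rfl fun x _ => Finset.sum_comm, Finset.sum_comm]
      _ = ∑ j, l j ^ 2 := by
          simp [hU, sq]
  rw [hl]
  refine le_trans (le_of_eq ?_) (sum_invariant_prod_le τ⁻¹ (fun e he => hτ e ?_) l)
  · calc ∑ a : F → κ, ∏ e, K (a e) (a (τ e))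
        = ∑ a : F → κ, ∑ J : F → κ, ∏ e, (l (J e) * (U (a e) (J e) * U (a (τ e)) (J e))) := by
          simp_rw [hKU]
          refine Finset.sum_congr rfl fun a _ => ?_
          rw [Finset.prod_univ_sum, Fintype.piFinset_univ]
      _ = ∑ J : F → κ, ∑ a : F → κ, (∏ e, l (J e)) * ∏ e, (U (a e) (J e) * U (a e) (J (τ⁻¹ e))) := by
          rw [Finset.sum_comm]
          refine Finset.sum_congr rfl fun J _ => Finset.sum_congr rfl fun a _ => ?_
          rw [Finset.prod_mul_distrib, Finset.prod_mul_distrib, Finset.prod_mul_distrib,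
            ← Equiv.prod_comp τ fun e => U (a e) (J (τ⁻¹ e))]
          simp
      _ = ∑ J : F → κ, (∏ e, l (J e)) * ∏ e, ∑ x, (U x (J e) * U x (J (τ⁻¹ e))) := by
          refine Finset.sum_congr rfl fun J _ => ?_
          rw [← Finset.mul_sum, Finset.prod_univ_sum, Fintype.piFinset_univ]
      _ = _ := by
          refine Finset.sum_congr rfl fun J _ => ?_
          simp_rw [hU]
          rw [Finset.prod_ite_zero]
          simp only [Finset.mem_univ, forall_true_left, Finset.prod_const_one, mul_ite, mul_one,
            mul_zero]
          simp only [eq_comm]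
  · rw [Equiv.Perm.inv_eq_iff_eq] at he
    exact he.symm

/-- A positive two-by-two matrix is conjugate by a diagonal matrix to a symmetric one. The
conjugating factors `c x / c y` cancel along `τ`. Symmetrizing first replaces the squares of the
off-diagonal entries by their product, which is essential for the sharp rate. -/
theorem sum_prod_pos_le (τ : Equiv.Perm F) (hτ : ∀ e, τ e ≠ e) {T : Bool → Bool → ℝ}
    (hT : ∀ x y, 0 < T x y) :
    ∑ a : F → Bool, ∏ e, T (a e) (a (τ e)) ≤
      √(T false false ^ 2 + T true true ^ 2 + 2 * (T false true * T true false)) ^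
        Fintype.card F := by
  let K : Bool → Bool → ℝ := fun x y => √(T x y * T y x)
  let c : Bool → ℝ := fun x => bif x then √(T true false / T false true) else 1
  have hc : ∀ x, 0 < c x := by
    intro x
    cases x
    · simp [c]
    · simp only [c, cond_true]
      exact Real.sqrt_pos.2 (div_pos (hT _ _) (hT _ _))
  have h01 := hT false true
  have h10 := hT true false
  have hTK : ∀ x y, T x y = K x y * (c x / c y) := by
    intro x y
    cases x <;> cases y <;> simp only [K, c, cond_true, cond_false]
    · rw [Real.sqrt_mul_self (hT _ _).le]; simp
    · rw [mul_one_div, ← Real.sqrt_div (mul_pos h01 h10).le]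
      rw [show T false true * T true false / (T true false / T false true) =
        T false true * T false true by field_simp, Real.sqrt_mul_self h01.le]
    · rw [div_one, ← Real.sqrt_mul (mul_pos h10 h01).le]
      rw [show T true false * T false true * (T true false / T false true) =
        T true false * T true false by field_simp, Real.sqrt_mul_self h10.le]
    · rw [Real.sqrt_mul_self (hT _ _).le, div_self (Real.sqrt_pos.2 (div_pos h10 h01)).ne', mul_one]
  have hK : ∑ x, ∑ y, K x y ^ 2 =
      T false false ^ 2 + T true true ^ 2 + 2 * (T false true * T true false) := by
    simp only [K, Fintype.sum_bool]
    rw [Real.sq_sqrt (mul_pos (hT _ _) (hT _ _)).le, Real.sq_sqrt (mul_pos (hT _ _) (hT _ _)).le,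
      Real.sq_sqrt (mul_pos (hT _ _) (hT _ _)).le, Real.sq_sqrt (mul_pos (hT _ _) (hT _ _)).le]
    ring
  rw [← hK]
  refine le_trans (le_of_eq ?_) (sum_prod_symm_le τ hτ (K := K) fun x y => ?_)
  · refine Finset.sum_congr rfl fun a _ => ?_
    simp_rw [hTK]
    rw [Finset.prod_mul_distrib, Finset.prod_div_distrib, Equiv.prod_comp τ fun e => c (a e),
      div_self (Finset.prod_ne_zero_iff.2 fun e _ => (hc _).ne'), mul_one]
  · simp only [K, mul_comm]

/-- Fixed points decouple from the rest and sum to 1, so only moved points count in the exponent. -/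
theorem sum_prod_ite_le (τ : Equiv.Perm F) {μ : Bool → ℝ} (hμ : ∑ x, μ x = 1)
    {T : Bool → Bool → ℝ} (hT : ∀ x y, 0 < T x y) :
    ∑ a : F → Bool, ∏ e, (if τ e = e then μ (a e) else T (a e) (a (τ e))) ≤
      √(T false false ^ 2 + T true true ^ 2 + 2 * (T false true * T true false)) ^
        (Finset.univ.filter fun e => τ e ≠ e).card := by
  let p : F → Prop := fun e => τ e = e
  have hp : ∀ x, ¬ p (τ x) ↔ ¬ p x := fun x => by simp [p]
  let τ' : Equiv.Perm {e // ¬ p e} := τ.subtypePerm hp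
  let G : ({e // p e} → Bool) × ({e // ¬ p e} → Bool) → ℝ := fun w =>
    (∏ e, μ (w.1 e)) * ∏ e, T (w.2 e) (w.2 (τ' e))
  have h1 : ∀ a : F → Bool, ∏ e, (if τ e = e then μ (a e) else T (a e) (a (τ e))) =
      G (Equiv.piEquivPiSubtypeProd p (fun _ => Bool) a) := by
    intro a
    rw [← Fintype.prod_subtype_mul_prod_subtype p]
    simp only [G]
    congr 1
    · refine Finset.prod_congr rfl fun e _ => ?_
      rw [if_pos e.2]
      rfl
    · refine Finset.prod_congr rfl fun e _ => ?_
      rw [if_neg e.2]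
      rfl
  simp_rw [h1]
  rw [Equiv.sum_comp, Fintype.sum_prod_type]
  simp only [G]
  simp_rw [← Finset.mul_sum]
  rw [← Finset.sum_mul]
  have h2 : ∑ u : {e // p e} → Bool, ∏ e, μ (u e) = 1 := by
    have := Finset.prod_univ_sum (fun _ : {e // p e} => (Finset.univ : Finset Bool))
      (fun _ x => μ x)
    rw [Fintype.piFinset_univ] at this
    rw [← this, hμ, Finset.prod_const_one]
  rw [h2, one_mul]
  refine (sum_prod_pos_le τ' (fun e he => e.2 (congrArg Subtype.val he)) hT).trans_eq ?_
  rw [Fintype.card_subtype]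

/-- A moment generating function bound for a pair of configurations with independent coordinates
of law `ρ`, where `g` couples the coordinate `e` with the coordinate `τ e`. -/
theorem sum_sum_prod_mul_le (τ : Equiv.Perm F) {ρ : Bool → Bool → ℝ} (hρ : ∑ x, ∑ y, ρ x y = 1)
    (g : Bool → Bool → Bool → ℝ) {T : Bool → Bool → ℝ} (hTg : ∀ x x', T x x' = ∑ y, ρ x y * g x x' y)
    (hT : ∀ x y, 0 < T x y) :
    ∑ a : F → Bool, ∑ b : F → Bool, (∏ e, ρ (a e) (b e)) *
        ∏ e, (if τ e = e then 1 else g (a e) (a (τ e)) (b e)) ≤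
      √(T false false ^ 2 + T true true ^ 2 + 2 * (T false true * T true false)) ^
        (Finset.univ.filter fun e => τ e ≠ e).card := by
  refine le_trans (le_of_eq ?_) (sum_prod_ite_le τ (μ := fun x => ∑ y, ρ x y) hρ hT)
  refine Finset.sum_congr rfl fun a _ => ?_
  have : ∀ e, (if τ e = e then ∑ y, ρ (a e) y else T (a e) (a (τ e))) =
      ∑ y, ρ (a e) y * (if τ e = e then 1 else g (a e) (a (τ e)) y) := by
    intro e
    split_ifs
    · simp
    · rw [hTg]
  simp_rw [this]
  rw [Finset.prod_univ_sum, Fintype.piFinset_univ]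
  refine Finset.sum_congr rfl fun b _ => ?_
  rw [Finset.prod_mul_distrib]

/-! ## Probabilities of events -/

theorem prob_le_sum {ρ : Bool → Bool → ℝ} (hρ : ∀ x y, 0 ≤ ρ x y)
    {Q : (F → Bool) → (F → Bool) → Prop} {f : (F → Bool) → (F → Bool) → ℝ}
    (hf : ∀ a b, 0 ≤ f a b) (hQ : ∀ a b, Q a b → 1 ≤ f a b) :
    prob ρ Q ≤ ∑ a, ∑ b, (∏ e, ρ (a e) (b e)) * f a b := by
  classical
  unfold prob
  refine Finset.sum_le_sum fun a _ => Finset.sum_le_sum fun b _ => ?_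
  have h : 0 ≤ ∏ e, ρ (a e) (b e) := Finset.prod_nonneg fun _ _ => hρ _ _
  split_ifs with hab
  · exact le_mul_of_one_le_right h (hQ a b hab)
  · exact mul_nonneg h (hf a b)

theorem prob_le_sum_prob {ι : Type*} {ρ : Bool → Bool → ℝ} (hρ : ∀ x y, 0 ≤ ρ x y)
    {Q : (F → Bool) → (F → Bool) → Prop} (s : Finset ι)
    (R : ι → (F → Bool) → (F → Bool) → Prop) (hQ : ∀ a b, Q a b → ∃ i ∈ s, R i a b) :
    prob ρ Q ≤ ∑ i ∈ s, prob ρ (R i) := by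
  classical
  unfold prob
  refine le_trans (b := ∑ a, ∑ b, ∑ i ∈ s, if R i a b then ∏ e, ρ (a e) (b e) else 0) ?_
    (le_of_eq ?_)
  swap
  · rw [Finset.sum_comm (s := s)]
    refine Finset.sum_congr rfl fun a _ => ?_
    rw [Finset.sum_comm]
  refine Finset.sum_le_sum fun a _ => Finset.sum_le_sum fun b _ => ?_
  have h : 0 ≤ ∏ e, ρ (a e) (b e) := Finset.prod_nonneg fun _ _ => hρ _ _
  have h' : ∀ i, 0 ≤ if R i a b then ∏ e, ρ (a e) (b e) else 0 := fun i => by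
    split_ifs
    · exact h
    · exact le_rfl
  split_ifs with hab
  · obtain ⟨i, hi, hR⟩ := hQ a b hab
    refine le_trans (le_of_eq ?_) (Finset.single_le_sum (fun i _ => h' i) hi)
    rw [if_pos hR]
  · exact Finset.sum_nonneg fun i _ => h' i

theorem prob_le_add {ρ : Bool → Bool → ℝ} (hρ : ∀ x y, 0 ≤ ρ x y)
    {Q Q₁ Q₂ : (F → Bool) → (F → Bool) → Prop} (hQ : ∀ a b, Q a b → Q₁ a b ∨ Q₂ a b) :
    prob ρ Q ≤ prob ρ Q₁ + prob ρ Q₂ := by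
  refine (prob_le_sum_prob hρ Finset.univ (fun i : Bool => bif i then Q₁ else Q₂)
    fun a b hab => ?_).trans_eq (by simp)
  rcases hQ a b hab with h | h
  · exact ⟨true, by simp, by simpa using h⟩
  · exact ⟨false, by simp, by simpa using h⟩

end CycleSums

/-! ## Exponential bounds for overlaps -/

section Chernoff

variable {F : Type*} [Fintype F] [DecidableEq F]

theorem pairWeight_true_true (p s : ℝ) : pairWeight p s true true = p * s ^ 2 := by
  simp [pairWeight, edgeWeight, keepWeight]; ring

theorem pairWeight_true_false (p s : ℝ) : pairWeight p s true false = p * s * (1 - s) := by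
  simp [pairWeight, edgeWeight, keepWeight]

theorem pairWeight_false_true (p s : ℝ) : pairWeight p s false true = p * s * (1 - s) := by
  simp [pairWeight, edgeWeight, keepWeight]; ring

theorem pairWeight_false_false (p s : ℝ) :
    pairWeight p s false false = p * (1 - s) ^ 2 + (1 - p) := by
  simp [pairWeight, edgeWeight, keepWeight]; ring

theorem sum_pairWeight (p s : ℝ) : ∑ x, ∑ y, pairWeight p s x y = 1 := by
  simp only [Fintype.sum_bool, pairWeight_true_true, pairWeight_true_false, pairWeight_false_true,
    pairWeight_false_false]
  ring

theorem sqrt_le_exp {x d : ℝ} (h : x ≤ 1 + 2 * d) : √x ≤ Real.exp d := by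
  rw [Real.sqrt_le_left (Real.exp_pos d).le, ← Real.exp_nat_mul]
  push_cast
  linarith [Real.add_one_le_exp (2 * d)]

/-- Exponential Markov: weight `z` for each edge in the identity overlap and `z⁻¹` for each edge in
the overlap of `τ`. With `z = √p`, the cost `p * (z⁻¹ - 1)` of accidental matches vanishes as `p →
0`, while the gain `1 - z` tends to 1. -/
theorem prob_overlap_one_le (τ : Equiv.Perm F) (p s : I) (hp0 : 0 < (p : ℝ)) (hp1 : (p : ℝ) < 1)
    (hs0 : 0 < (s : ℝ)) :
    prob (pairWeight p s) (fun a b : F → Bool => overlap 1 a b ≤ overlap τ a b) ≤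
      Real.exp (-(p * s ^ 2 * (1 - p * s) * (1 - √p) ^ 2 *
        (Finset.univ.filter fun e => τ e ≠ e).card)) := by
  set z := √(p : ℝ) with hz
  have hz0 : 0 < z := Real.sqrt_pos.2 hp0
  have hzp : (p : ℝ) = z ^ 2 := (Real.sq_sqrt hp0.le).symm
  have hz1 : z < 1 := by rw [hz, Real.sqrt_lt' one_pos]; simpa using hp1
  have hs1 : (s : ℝ) ≤ 1 := s.2.2
  let g : Bool → Bool → Bool → ℝ := fun x x' y =>
    (if x = true ∧ y = true then z else 1) * (if x' = true ∧ y = true then z⁻¹ else 1)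
  have hg0 : ∀ x x' y, 0 ≤ g x x' y := by
    intro x x' y
    simp only [g]
    split_ifs <;> positivity
  have hgf : ∀ a b : F → Bool, ∏ e, (if τ e = e then 1 else g (a e) (a (τ e)) (b e)) =
      z ^ overlap 1 a b * z⁻¹ ^ overlap τ a b := by
    intro a b
    -- At a fixed point the weights `z` and `z⁻¹` occur together and cancel.
    have : ∀ e, (if τ e = e then 1 else g (a e) (a (τ e)) (b e)) = g (a e) (a (τ e)) (b e) := by
      intro e
      split_ifs with h
      · simp only [h, g]
        split_ifs
        · rw [mul_inv_cancel₀ hz0.ne']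
        · simp
      · rfl
    simp_rw [this]
    simp only [g, overlap]
    rw [Finset.prod_mul_distrib, Finset.prod_ite, Finset.prod_ite, Finset.prod_const,
      Finset.prod_const]
    simp only [one_pow, Finset.prod_const, mul_one, Equiv.Perm.coe_one, id_eq]
    congr!
  refine (prob_le_sum (pairWeight_nonneg p s)
    (f := fun a b => ∏ e, (if τ e = e then 1 else g (a e) (a (τ e)) (b e)))
    (fun a b => Finset.prod_nonneg fun e _ => ?_) fun a b hab => ?_).trans ?_
  · split_ifs
    · exact zero_le_one
    · exact hg0 _ _ _
  · rw [hgf]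
    calc (1 : ℝ) = z ^ overlap 1 a b * z⁻¹ ^ overlap 1 a b := by
          rw [← mul_pow, mul_inv_cancel₀ hz0.ne', one_pow]
      _ ≤ _ := by
          gcongr
          exact (one_le_inv₀ hz0).2 hz1.le
  · let T : Bool → Bool → ℝ := fun x x' => ∑ y, pairWeight p s x y * g x x' y
    have hT00 : T false false = 1 - p * s := by
      simp [T, g, pairWeight_false_true, pairWeight_false_false]; ring
    have hT11 : T true true = p * s := by
      simp [T, g, pairWeight_true_true, pairWeight_true_false, hz0.ne']; ring
    have hT10 : T true false = p * s * (1 - s * (1 - z)) := by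
      simp [T, g, pairWeight_true_true, pairWeight_true_false]; ring
    have hT01 : T false true = (1 - p * s) + z * s * (1 - s) * (1 - z) := by
      simp [T, g, pairWeight_false_true, pairWeight_false_false]
      rw [hzp]
      field_simp
      ring
    have hps : (p : ℝ) * s < 1 := by nlinarith
    have hsz : (s : ℝ) * (1 - z) < 1 := by nlinarith
    have hT : ∀ x y, 0 < T x y := by
      intro x y
      cases x <;> cases y
      · rw [hT00]; linarith
      · rw [hT01]
        have : 0 ≤ z * s * (1 - s) * (1 - z) := mul_nonneg (mul_nonneg (by positivity)
          (by linarith)) (by linarith)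
        linarith
      · rw [hT10]
        exact mul_pos (by positivity) (by linarith)
      · rw [hT11]; positivity
    refine (sum_sum_prod_mul_le τ (sum_pairWeight p s) g (T := T) (fun _ _ => rfl) hT).trans ?_
    rw [hT00, hT11, hT10, hT01]
    have hle : (1 - p * s) + z * s * (1 - s) * (1 - z) ≤ (1 - p * s) * (1 + z * s * (1 - z)) := by
      have h1 : 0 ≤ z * s * (1 - z) := mul_nonneg (by positivity) (by linarith)
      have h2 : (p : ℝ) * s ≤ s := by nlinarith
      nlinarith
    have h3 : ((1 - p * s : ℝ) + z * s * (1 - s) * (1 - z)) * (p * s * (1 - s * (1 - z))) ≤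
        p * s * (1 - p * s) * (1 - s * (1 - z) ^ 2) := by
      have h4 : 0 ≤ (p : ℝ) * s * (1 - s * (1 - z)) := mul_nonneg (by positivity) (by linarith)
      refine (mul_le_mul_of_nonneg_right hle h4).trans ?_
      have h5 : 0 ≤ (p : ℝ) * s * (1 - p * s) := mul_nonneg (by positivity) (by linarith)
      have h6 : (1 + z * s * (1 - z)) * (1 - s * (1 - z)) ≤ 1 - s * (1 - z) ^ 2 := by
        have : 0 ≤ z * (s * (1 - z)) ^ 2 := by positivity
        nlinarith
      calc _ = p * s * (1 - p * s) * ((1 + z * s * (1 - z)) * (1 - s * (1 - z))) := by ring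
        _ ≤ _ := mul_le_mul_of_nonneg_left h6 h5
    calc _ ≤ Real.exp (-(p * s ^ 2 * (1 - p * s) * (1 - z) ^ 2)) ^
            (Finset.univ.filter fun e => τ e ≠ e).card := by
          gcongr
          refine sqrt_le_exp ?_
          nlinarith
      _ = _ := by
          rw [← Real.exp_nat_mul]
          congr 1
          ring

/-- The overlap restricted to the points moved by `τ`. -/
def movedOverlap (τ : Equiv.Perm F) (a b : F → Bool) : ℕ :=
  (Finset.univ.filter fun e => τ e ≠ e ∧ a (τ e) = true ∧ b e = true).card

/-- At a moved point `a (τ e)` and `b e` come from different base edges, so a match has probability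
at most `p ^ 2`. This explains the order of the exponent; dependence along cycles is absorbed by the
Hilbert–Schmidt bound. -/
theorem prob_le_movedOverlap_le (τ : Equiv.Perm F) (p s : I) (hp0 : 0 < (p : ℝ))
    (hp1 : (p : ℝ) < 1) (hs0 : 0 < (s : ℝ)) {c : ℝ} (hc : 0 ≤ c) (t : ℝ) :
    prob (pairWeight p s) (fun a b : F → Bool => t ≤ movedOverlap τ a b) ≤
      Real.exp (2 * p ^ 2 * Real.exp c ^ 2 * (Finset.univ.filter fun e => τ e ≠ e).card -
        c * t) := by
  set L := Real.exp c with hL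
  have hL1 : 1 ≤ L := Real.one_le_exp hc
  have hs1 : (s : ℝ) ≤ 1 := s.2.2
  let g : Bool → Bool → Bool → ℝ := fun _ x' y => if x' = true ∧ y = true then L else 1
  have hgf : ∀ a b : F → Bool, ∏ e, (if τ e = e then 1 else g (a e) (a (τ e)) (b e)) =
      L ^ movedOverlap τ a b := by
    intro a b
    have : ∀ e, (if τ e = e then 1 else g (a e) (a (τ e)) (b e)) =
        if τ e ≠ e ∧ a (τ e) = true ∧ b e = true then L else 1 := by
      intro e
      by_cases h : τ e = e <;> simp [h, g]
    simp_rw [this, movedOverlap]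
    rw [Finset.prod_ite, Finset.prod_const]
    simp
  have hL0 : 0 < L := Real.exp_pos _
  refine (prob_le_sum (pairWeight_nonneg p s)
    (f := fun a b => (∏ e, (if τ e = e then 1 else g (a e) (a (τ e)) (b e))) * Real.exp (-(c * t)))
    (fun a b => ?_) fun a b hab => ?_).trans ?_
  · rw [hgf]
    positivity
  · rw [hgf, hL, ← Real.exp_nat_mul, ← Real.exp_add]
    refine Real.one_le_exp ?_
    have := mul_le_mul_of_nonneg_left hab hc
    linarith
  · let T : Bool → Bool → ℝ := fun x x' => ∑ y, pairWeight p s x y * g x x' y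
    have hT00 : T false false = 1 - p * s := by
      simp [T, g, pairWeight_false_true, pairWeight_false_false]; ring
    have hT10 : T true false = p * s := by
      simp [T, g, pairWeight_true_true, pairWeight_true_false]; ring
    have hT11 : T true true = p * s * (1 - s + s * L) := by
      simp [T, g, pairWeight_true_true, pairWeight_true_false]; ring
    have hT01 : T false true = (1 - p * s) + p * s * (1 - s) * (L - 1) := by
      simp [T, g, pairWeight_false_true, pairWeight_false_false]; ring
    have hps : (p : ℝ) * s < 1 := by nlinarith
    have hps0 : (0 : ℝ) < p * s := by positivity
    have hpsp : (p : ℝ) * s ≤ p := by nlinarith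
    have h1s : 0 ≤ (1 - s : ℝ) := by linarith
    have hT : ∀ x y, 0 < T x y := by
      intro x y
      cases x <;> cases y
      · rw [hT00]; linarith
      · rw [hT01]
        have : 0 ≤ (p : ℝ) * s * (1 - s) * (L - 1) := mul_nonneg (by positivity) (by linarith)
        linarith
      · rw [hT10]; positivity
      · rw [hT11]; positivity
    simp_rw [← mul_assoc, ← Finset.sum_mul]
    refine (mul_le_mul_of_nonneg_right
      (sum_sum_prod_mul_le τ (sum_pairWeight p s) g (T := T) (fun _ _ => rfl) hT)
      (Real.exp_pos _).le).trans ?_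
    rw [hT00, hT11, hT10, hT01]
    have h1 : ((p : ℝ) * s * (1 - s + s * L)) ^ 2 ≤ p ^ 2 * L ^ 2 := by
      rw [← mul_pow]
      gcongr
      nlinarith
    have h2 : ((p : ℝ) * s) * (p * s * (1 - s) * (L - 1)) ≤ p ^ 2 * L ^ 2 := by
      have h3 : (p : ℝ) * s * (1 - s) * (L - 1) ≤ p * L ^ 2 := by
        have h4 : (p : ℝ) * s * (1 - s) ≤ p := by nlinarith
        have h5 : L - 1 ≤ L ^ 2 := by nlinarith
        exact mul_le_mul h4 h5 (by linarith) hp0.le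
      calc _ ≤ (p : ℝ) * (p * L ^ 2) :=
            mul_le_mul hpsp h3 (mul_nonneg (by positivity) (by linarith)) hp0.le
        _ = _ := by ring
    calc _ ≤ Real.exp (2 * p ^ 2 * L ^ 2) ^ (Finset.univ.filter fun e => τ e ≠ e).card *
            Real.exp (-(c * t)) := by
          gcongr
          refine sqrt_le_exp ?_
          nlinarith [sq_nonneg ((p : ℝ) * L), sq_nonneg ((p : ℝ) * s)]
      _ = _ := by
          rw [← Real.exp_nat_mul, ← Real.exp_add]
          congr 1
          ring

/-- Lower-tail Chernoff bound for a binomial count with success probability `ps²`, at parameter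
`-1`; the factor `1/2` comes from `exp (-1) ≤ 1/2`. -/
theorem prob_card_common_le (J : Finset F) (p s : I) (t : ℝ) :
    prob (pairWeight p s) (fun a b : F → Bool =>
        ((J.filter fun e => a e = true ∧ b e = true).card : ℝ) ≤ t) ≤
      Real.exp (t - p * s ^ 2 / 2 * J.card) := by
  have hp0 : 0 ≤ (p : ℝ) := p.2.1
  let q := Real.exp (-1)
  have hq0 : 0 < q := Real.exp_pos _
  have hq : q ≤ 1 / 2 := by
    have := Real.exp_neg_one_lt_d9
    simp only [q]
    linarith
  let g : F → Bool → Bool → ℝ := fun e x y => if e ∈ J ∧ x = true ∧ y = true then q else 1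
  have hgf : ∀ a b : F → Bool, ∏ e, g e (a e) (b e) =
      q ^ (J.filter fun e => a e = true ∧ b e = true).card := by
    intro a b
    simp only [g]
    rw [Finset.prod_ite, Finset.prod_const, Finset.prod_const_one, mul_one]
    congr 2
    ext e
    simp
  refine (prob_le_sum (pairWeight_nonneg p s)
    (f := fun a b => (∏ e, g e (a e) (b e)) * Real.exp t)
    (fun a b => ?_) fun a b hab => ?_).trans ?_
  · rw [hgf]
    positivity
  · rw [hgf, ← Real.exp_nat_mul, ← Real.exp_add]
    exact Real.one_le_exp (by linarith)
  · simp_rw [← mul_assoc, ← Finset.sum_mul]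
    have h : ∑ a : F → Bool, ∑ b : F → Bool, (∏ e, pairWeight p s (a e) (b e)) *
        ∏ e, g e (a e) (b e) = ∏ e, ∑ x, ∑ y, pairWeight p s x y * g e x y := by
      rw [Finset.prod_univ_sum, Fintype.piFinset_univ]
      refine Finset.sum_congr rfl fun a _ => ?_
      rw [Finset.prod_univ_sum, Fintype.piFinset_univ]
      refine Finset.sum_congr rfl fun b _ => ?_
      rw [Finset.prod_mul_distrib]
    have h2 : ∏ e, ∑ x, ∑ y, pairWeight p s x y * g e x y =
        ∏ e, if e ∈ J then 1 - p * s ^ 2 * (1 - q) else 1 := by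
      refine Finset.prod_congr rfl fun e _ => ?_
      simp only [Fintype.sum_bool, pairWeight_true_true, pairWeight_true_false,
        pairWeight_false_true, pairWeight_false_false, g]
      by_cases he : e ∈ J <;> simp [he] <;> ring
    have h3 : ∏ e, (if e ∈ J then 1 - p * s ^ 2 * (1 - q) else (1 : ℝ)) =
        (1 - p * s ^ 2 * (1 - q)) ^ J.card := by
      rw [Finset.prod_ite, Finset.prod_const, Finset.prod_const_one, mul_one]
      congr 2
      ext e
      simp
    rw [h, h2, h3]
    have hps : (p : ℝ) * s ^ 2 ≤ 1 := by
      have := p.2.2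
      have h1 := s.2.2
      have h0 := s.2.1
      have : (s : ℝ) ^ 2 ≤ 1 := pow_le_one₀ h0 h1
      nlinarith [sq_nonneg (s : ℝ)]
    have hps0 : 0 ≤ (p : ℝ) * s ^ 2 := by positivity
    calc _ ≤ Real.exp (-(p * s ^ 2 / 2)) ^ J.card * Real.exp t := by
          gcongr
          · nlinarith
          · have := Real.add_one_le_exp (-(p * s ^ 2 / 2 : ℝ))
            nlinarith
      _ = _ := by
          rw [← Real.exp_nat_mul, ← Real.exp_add]
          congr 1
          ring

end Chernoff

/-! ## Counting pairs and permutations -/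

section Counting

variable {n : ℕ}

/-- The pairs of vertices moved by `τ`. -/
def movedPairs (τ : Equiv.Perm (Fin n)) : Finset (Pairs n) :=
  Finset.univ.filter fun e => pairPerm τ e ≠ e

open Classical in
/-- The pairs of vertices that meet `S`. -/
noncomputable def incidentPairs (S : Finset (Fin n)) : Finset (Pairs n) :=
  Finset.univ.filter fun e => ∃ i ∈ S, i ∈ e.1

theorem mem_movedPairs {τ : Equiv.Perm (Fin n)} {e : Pairs n} :
    e ∈ movedPairs τ ↔ e.1.map τ ≠ e.1 := by
  simp only [movedPairs, Finset.mem_filter, Finset.mem_univ, true_and, ne_eq, Subtype.ext_iff,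
    coe_pairPerm]

/-- A pair joining a moved vertex to a fixed one is moved. For small supports this count is nearly
`n` per moved vertex, without the factor `1/2` of the general bound. -/
theorem mul_le_card_movedPairs (τ : Equiv.Perm (Fin n)) :
    τ.support.card * (n - τ.support.card) ≤ (movedPairs τ).card := by
  classical
  have h : (τ.support ×ˢ τ.supportᶜ).card = τ.support.card * (n - τ.support.card) := by
    rw [Finset.card_product, Finset.card_compl, Fintype.card_fin]
  rw [← h, ← Finset.card_map (Function.Embedding.subtype _)]
  refine Finset.card_le_card_of_injOn (fun z => s(z.1, z.2)) ?_ ?_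
  · rintro ⟨i, j⟩ hij
    simp only [Finset.coe_product, Set.mem_prod, Finset.mem_coe, Finset.mem_compl,
      Equiv.Perm.mem_support, not_not] at hij
    have hne : i ≠ j := fun h => hij.1 (h ▸ hij.2)
    simp only [Finset.coe_map, Set.mem_image, Finset.mem_coe, mem_movedPairs,
      Function.Embedding.subtype_apply]
    refine ⟨⟨s(i, j), by simpa using hne⟩, ?_, rfl⟩
    simp only [Sym2.map_mk, ne_eq, Sym2.eq_iff, not_or, hij.2]
    exact ⟨fun h => hij.1 h.1, fun h => hne h.2.symm⟩
  · rintro ⟨i, j⟩ hij ⟨i', j'⟩ hij' h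
    simp only [Finset.coe_product, Set.mem_prod, Finset.mem_coe, Finset.mem_compl] at hij hij'
    rcases Sym2.eq_iff.1 h with ⟨rfl, rfl⟩ | ⟨rfl, rfl⟩
    · rfl
    · exact absurd hij.1 hij'.2

theorem card_movedPairs_le (τ : Equiv.Perm (Fin n)) :
    (movedPairs τ).card ≤ τ.support.card * n := by
  classical
  have h : (τ.support ×ˢ (Finset.univ : Finset (Fin n))).card = τ.support.card * n := by
    rw [Finset.card_product, Finset.card_univ, Fintype.card_fin]
  rw [← h, ← Finset.card_map (Function.Embedding.subtype _)]
  refine le_trans (Finset.card_le_card fun e he => ?_)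
    (Finset.card_image_le (f := fun z : Fin n × Fin n => s(z.1, z.2)))
  simp only [Finset.mem_map, mem_movedPairs, Function.Embedding.subtype_apply] at he
  obtain ⟨⟨e, hd⟩, he, rfl⟩ := he
  induction e using Sym2.ind with
  | _ i j =>
  simp only [Finset.mem_image, Finset.mem_product, Finset.mem_univ, and_true, Prod.exists,
    Equiv.Perm.mem_support]
  by_cases hi : τ i = i
  · refine ⟨j, i, fun hj => he ?_, Sym2.eq_swap⟩
    simp [hi, hj]
  · exact ⟨i, j, hi, rfl⟩

/-- A pair that meets the support but is not moved must be swapped, hence of the form `s(i, τ i)`.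
-/
theorem card_filter_incidentPairs_le (τ : Equiv.Perm (Fin n)) (P : Pairs n → Prop)
    [DecidablePred P] :
    ((incidentPairs τ.support).filter P).card ≤
      ((movedPairs τ).filter P).card + τ.support.card := by
  classical
  rw [← Finset.card_map (Function.Embedding.subtype _),
    ← Finset.card_map (s := (movedPairs τ).filter P) (Function.Embedding.subtype _)]
  refine le_trans (Finset.card_le_card fun e he => ?_) ((Finset.card_union_le _ _).trans
    (Nat.add_le_add_left (Finset.card_image_le (f := fun i => s(i, τ i))) _))
  simp only [Finset.mem_map, Finset.mem_filter, incidentPairs, Finset.mem_univ, true_and,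
    Function.Embedding.subtype_apply] at he
  obtain ⟨e, ⟨⟨i, hi, hie⟩, hP⟩, rfl⟩ := he
  rw [Finset.mem_union]
  by_cases hm : e ∈ movedPairs τ
  · left
    exact Finset.mem_map.2 ⟨e, Finset.mem_filter.2 ⟨hm, hP⟩, rfl⟩
  · right
    obtain ⟨j, hj⟩ := Sym2.mem_iff_exists.1 hie
    rw [mem_movedPairs, not_not, hj, Sym2.map_mk, Sym2.eq_iff] at hm
    rw [Equiv.Perm.mem_support] at hi
    refine Finset.mem_image.2 ⟨i, by simpa using hi, ?_⟩
    rcases hm with hm | hm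
    · exact absurd hm.1 hi
    · rw [hj, hm.1]

theorem mul_le_two_mul_card_incidentPairs (S : Finset (Fin n)) :
    (S.card : ℝ) * (n - 1) ≤ 2 * (incidentPairs S).card := by
  classical
  let h : Sym2 (Fin n) → ℝ := fun e => if ¬ e.IsDiag ∧ ∃ i ∈ S, i ∈ e then 1 else 0
  have h1 : ((incidentPairs S).card : ℝ) = ∑ e : Pairs n, h e.1 := by
    simp only [h]
    rw [Finset.sum_boole, incidentPairs]
    congr 2
    ext e
    simp [e.2]
  rw [h1, ← sum_sum_sym2 h (by intro e he; simp [h, he])]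
  calc (S.card : ℝ) * (n - 1) = ∑ i ∈ S, ∑ j ∈ Finset.univ.erase i, (1 : ℝ) := by
        rw [Finset.sum_congr rfl (g := fun _ => (n - 1 : ℝ)), Finset.sum_const, nsmul_eq_mul]
        intro i _
        rw [Finset.sum_erase_eq_sub (Finset.mem_univ i)]
        simp
    _ ≤ ∑ i ∈ S, ∑ j, h s(i, j) := by
        refine Finset.sum_le_sum fun i hi => ?_
        have h3 : ∀ e, 0 ≤ h e := fun e => by
          simp only [h]
          split_ifs <;> simp
        refine le_trans (Finset.sum_le_sum fun j hj => ?_)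
          (Finset.sum_le_sum_of_subset_of_nonneg (Finset.erase_subset _ _) fun _ _ _ => h3 _)
        simp only [h]
        rw [if_pos]
        refine ⟨?_, i, hi, Sym2.mem_mk_left _ _⟩
        rw [Sym2.mk_isDiag_iff]
        exact (Finset.ne_of_mem_erase hj).symm
    _ ≤ _ := by
        refine Finset.sum_le_sum_of_subset_of_nonneg (Finset.subset_univ _) fun i _ _ => ?_
        refine Finset.sum_nonneg fun j _ => ?_
        simp only [h]
        split_ifs <;> simp

theorem card_filter_support_eq_le (S : Finset (Fin n)) :
    (Finset.univ.filter fun τ : Equiv.Perm (Fin n) => τ.support = S).card ≤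
      S.card.factorial := by
  classical
  have h := Fintype.card_congr (Equiv.Perm.subtypeEquivSubtypePerm fun i => i ∈ S)
  rw [Fintype.card_perm, Fintype.card_coe, Fintype.card_subtype] at h
  rw [h]
  refine Finset.card_le_card fun τ hτ => ?_
  simp only [Finset.mem_filter, Finset.mem_univ, true_and] at hτ ⊢
  intro i hi
  rwa [← hτ, Equiv.Perm.mem_support, not_not] at hi

theorem sum_range_pow_succ_le {y : ℝ} (hy0 : 0 ≤ y) (hy : y ≤ 1 / 2) (m : ℕ) :
    ∑ k ∈ Finset.range m, y ^ (k + 1) ≤ 2 * y := by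
  have h := mul_neg_geom_sum y m
  have h1 : 0 ≤ y ^ m := by positivity
  have h2 : 0 ≤ ∑ k ∈ Finset.range m, y ^ k := Finset.sum_nonneg fun _ _ => by positivity
  have h3 : ∑ k ∈ Finset.range m, y ^ k ≤ 2 := by nlinarith
  simp_rw [pow_succ]
  rw [← Finset.sum_mul]
  nlinarith

theorem sum_nonempty_card_le {f : ℕ → ℝ} {y : ℝ} (hy0 : 0 ≤ y) (hy : y ≤ 1 / 2)
    (hf : ∀ k, 1 ≤ k → (n.choose k : ℝ) * f k ≤ y ^ k) :
    ∑ S ∈ Finset.univ.filter (fun S : Finset (Fin n) => S.Nonempty), f S.card ≤ 2 * y := by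
  have h := Finset.sum_powerset_apply_card (fun k => if k = 0 then 0 else f k)
    (x := (Finset.univ : Finset (Fin n)))
  rw [Finset.powerset_univ, Finset.card_univ, Fintype.card_fin] at h
  rw [Finset.sum_filter]
  calc _ = ∑ S : Finset (Fin n), if S.card = 0 then 0 else f S.card := by
        refine Finset.sum_congr rfl fun S _ => ?_
        by_cases hS : S = ∅ <;> simp [hS, Finset.nonempty_iff_ne_empty]
    _ = ∑ k ∈ Finset.range n, (n.choose (k + 1) : ℝ) * f (k + 1) := by
        rw [h, Finset.sum_range_succ']
        simp
    _ ≤ ∑ k ∈ Finset.range n, y ^ (k + 1) := Finset.sum_le_sum fun k _ => hf _ (by omega)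
    _ ≤ 2 * y := sum_range_pow_succ_le hy0 hy n

/-- At most `n.choose k * k! ≤ n ^ k` permutations have support of size `k`; sum the geometric
series from `k = 1`. -/
theorem sum_ne_one_pow_card_support_le {x : ℝ} (hx0 : 0 ≤ x) (hx : n * x ≤ 1 / 2) :
    ∑ τ ∈ Finset.univ.filter (fun τ : Equiv.Perm (Fin n) => τ ≠ 1), x ^ τ.support.card ≤
      2 * (n * x) := by
  classical
  calc _ = ∑ S ∈ Finset.univ.filter (fun S : Finset (Fin n) => S.Nonempty),
        ∑ τ ∈ (Finset.univ.filter (fun τ : Equiv.Perm (Fin n) => τ ≠ 1)).filter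
          (fun τ => τ.support = S), x ^ τ.support.card := by
        refine (Finset.sum_fiberwise_of_maps_to (fun τ hτ => ?_) _).symm
        simp only [Finset.mem_filter, Finset.mem_univ, true_and] at hτ ⊢
        rw [Finset.nonempty_iff_ne_empty, ne_eq, Equiv.Perm.support_eq_empty_iff]
        exact hτ
    _ ≤ ∑ S ∈ Finset.univ.filter (fun S : Finset (Fin n) => S.Nonempty),
        (S.card.factorial : ℝ) * x ^ S.card := by
        refine Finset.sum_le_sum fun S _ => ?_
        rw [Finset.sum_congr rfl (g := fun _ => x ^ S.card) (fun τ hτ => by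
          rw [(Finset.mem_filter.1 hτ).2]), Finset.sum_const, nsmul_eq_mul]
        gcongr
        exact (Finset.card_le_card (Finset.filter_subset_filter _ (Finset.filter_subset _ _))).trans
          (card_filter_support_eq_le S)
    _ ≤ _ := by
        refine sum_nonempty_card_le (f := fun k => (k.factorial : ℝ) * x ^ k) (by positivity) hx
          fun k _ => ?_
        rw [mul_pow, ← mul_assoc]
        gcongr
        rw [mul_comm]
        exact_mod_cast (Nat.descFactorial_eq_factorial_mul_choose n k).symm.le.trans
          (Nat.descFactorial_le_pow n k)

theorem choose_le_exp_mul_pow {k : ℕ} (hk : 1 ≤ k) (n : ℕ) :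
    (n.choose k : ℝ) ≤ (Real.exp 1 * (n / k)) ^ k := by
  have hk0 : (0 : ℝ) < k := by exact_mod_cast hk
  have h1 := Nat.choose_le_pow_div (α := ℝ) k n
  -- One term of the exponential series at `k` gives `k ^ k ≤ exp k * k!`.
  have h2 := Real.pow_div_factorial_le_exp (k : ℝ) hk0.le k
  refine h1.trans ?_
  rw [mul_pow, ← Real.exp_nat_mul, mul_one, div_pow]
  rw [div_le_iff₀ (by positivity)] at h2 ⊢
  calc (n : ℝ) ^ k = (k : ℝ) ^ k * ((n : ℝ) ^ k / k ^ k) := by field_simp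
    _ ≤ (Real.exp k * k.factorial) * ((n : ℝ) ^ k / k ^ k) := by gcongr
    _ = _ := by ring

end Counting

/-! ## Confusable configurations are unlikely -/

section Confusable

variable {n : ℕ}

theorem mul_exp_neg_two_log {n : ℕ} (hn : 1 ≤ n) :
    (n : ℝ) * Real.exp (-(2 * Real.log n)) = (n : ℝ)⁻¹ := by
  have hn0 : (0 : ℝ) < n := by exact_mod_cast hn
  rw [two_mul, neg_add, Real.exp_add, Real.exp_neg, Real.exp_log hn0]
  field_simp

theorem card_support_mul_le_card_movedPairs (τ : Equiv.Perm (Fin n)) :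
    (τ.support.card : ℝ) * (n - 3) ≤ 2 * (movedPairs τ).card := by
  have h1 := mul_le_two_mul_card_incidentPairs τ.support
  have h2 := card_filter_incidentPairs_le τ fun _ => True
  simp only [Finset.filter_true] at h2
  have h3 : ((incidentPairs τ.support).card : ℝ) ≤ (movedPairs τ).card + τ.support.card := by
    exact_mod_cast h2
  linarith

theorem prob_confusable_le_of_dense (p s : I) (hp0 : 0 < (p : ℝ)) (hp1 : (p : ℝ) < 1)
    (hs0 : 0 < (s : ℝ)) (hn : 6 ≤ n)
    (h : 8 * Real.log n ≤ n * (p * s ^ 2 * (1 - p * s) * (1 - √p) ^ 2)) :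
    prob (pairWeight p s) (Confusable (n := n)) ≤ 2 * (n : ℝ)⁻¹ := by
  classical
  set δ := (p * s ^ 2 * (1 - p * s) * (1 - √p) ^ 2 : ℝ) with hδ
  have hn' : (6 : ℝ) ≤ n := by exact_mod_cast hn
  have hδ0 : 0 ≤ δ := by
    have : (p : ℝ) * s ≤ 1 := mul_le_one₀ hp1.le hs0.le s.2.2
    have : 0 ≤ 1 - (p : ℝ) * s := by linarith
    positivity
  rw [← mul_exp_neg_two_log (by omega : 1 ≤ n)]
  refine (prob_le_sum_prob (pairWeight_nonneg p s)
    (Finset.univ.filter fun τ : Equiv.Perm (Fin n) => τ ≠ 1)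
    (fun τ a b => overlap 1 a b ≤ overlap (pairPerm τ) a b) ?_).trans ?_
  · rintro a b ⟨τ, hτ, h⟩
    exact ⟨τ, by simpa using hτ, h⟩
  · refine le_trans (Finset.sum_le_sum fun τ _ => ?_) (sum_ne_one_pow_card_support_le
      (Real.exp_pos _).le ?_)
    · refine (prob_overlap_one_le (pairPerm τ) p s hp0 hp1 hs0).trans ?_
      rw [← Real.exp_nat_mul, ← hδ]
      refine Real.exp_le_exp.2 ?_
      have h1 := card_support_mul_le_card_movedPairs τ
      -- With the factor 8 in `h`, a quarter of `n` per moved vertex leaves the decay `exp (-(2 *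
      -- log n))` needed for the union bound.
      have h2 : (τ.support.card : ℝ) * (n / 4) ≤ (movedPairs τ).card := by
        have : (τ.support.card : ℝ) * (n / 2) ≤ τ.support.card * (n - 3) := by
          gcongr
          linarith
        linarith
      have h3 := mul_le_mul_of_nonneg_left h2 hδ0
      have h4 := mul_le_mul_of_nonneg_left h (Nat.cast_nonneg (α := ℝ) τ.support.card)
      unfold movedPairs at h3
      linarith
    · rw [mul_exp_neg_two_log (by omega), inv_le_comm₀ (by linarith) (by norm_num)]
      linarith

/-- Fixed pairs contribute equally to both overlaps, so they cancel from the comparison. -/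
theorem card_filter_movedPairs_le_movedOverlap {τ : Equiv.Perm (Fin n)} {a b : Pairs n → Bool}
    (h : overlap 1 a b ≤ overlap (pairPerm τ) a b) :
    ((movedPairs τ).filter fun e => a e = true ∧ b e = true).card ≤
      movedOverlap (pairPerm τ) a b := by
  classical
  have h1 : overlap 1 a b = ((movedPairs τ).filter fun e => a e = true ∧ b e = true).card +
      (Finset.univ.filter fun e => pairPerm τ e = e ∧ a e = true ∧ b e = true).card := by
    rw [overlap, ← Finset.card_filter_add_card_filter_not (fun e => pairPerm τ e ≠ e),
      Finset.filter_filter, Finset.filter_filter, movedPairs, Finset.filter_filter]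
    congr 2 <;> ext e <;> rw [Finset.mem_filter, Finset.mem_filter] <;>
      simp only [Finset.mem_univ, true_and, not_not, ne_eq, Equiv.Perm.coe_one, id_eq] <;> tauto
  have h2 : overlap (pairPerm τ) a b = movedOverlap (pairPerm τ) a b +
      (Finset.univ.filter fun e => pairPerm τ e = e ∧ a e = true ∧ b e = true).card := by
    rw [overlap, ← Finset.card_filter_add_card_filter_not (fun e => pairPerm τ e ≠ e),
      Finset.filter_filter, Finset.filter_filter, movedOverlap]
    congr 2 <;> ext e <;> simp
    · tauto
    · constructor
      · rintro ⟨h, h'⟩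
        rw [h'] at h
        exact ⟨h', h⟩
      · rintro ⟨h', h⟩
        rw [h']
        exact ⟨h, rfl⟩
  omega

/-- For a large support, either few common edges meet it, or many do; in the latter case all but one
per moved vertex lie on moved pairs, and `τ` must match as many by chance. The second alternative
depends on `τ` only through its support, so its union bound runs over sets instead of permutations.
-/
theorem Confusable.cases {a b : Pairs n → Bool} (h : Confusable a b) (x t : ℝ) :
    (∃ τ : Equiv.Perm (Fin n), τ ≠ 1 ∧ (τ.support.card : ℝ) ≤ x ∧
      overlap 1 a b ≤ overlap (pairPerm τ) a b) ∨
    (∃ S : Finset (Fin n), S.Nonempty ∧ x < S.card ∧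
      (((incidentPairs S).filter fun e => a e = true ∧ b e = true).card : ℝ) ≤
        S.card * (t + 1)) ∨
    ∃ τ : Equiv.Perm (Fin n), τ ≠ 1 ∧ τ.support.card * t ≤ movedOverlap (pairPerm τ) a b := by
  obtain ⟨τ, hτ, h⟩ := h
  by_cases h1 : (τ.support.card : ℝ) ≤ x
  · exact Or.inl ⟨τ, hτ, h1, h⟩
  · right
    by_cases h2 : (((incidentPairs τ.support).filter fun e => a e = true ∧ b e = true).card : ℝ) ≤
        τ.support.card * (t + 1)
    · refine Or.inl ⟨τ.support, ?_, not_le.1 h1, h2⟩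
      rw [Finset.nonempty_iff_ne_empty, ne_eq, Equiv.Perm.support_eq_empty_iff]
      exact hτ
    · refine Or.inr ⟨τ, hτ, ?_⟩
      have h3 : (((incidentPairs τ.support).filter fun e => a e = true ∧ b e = true).card : ℝ) ≤
          movedOverlap (pairPerm τ) a b + τ.support.card := by
        exact_mod_cast (card_filter_incidentPairs_le τ _).trans
          (Nat.add_le_add_right (card_filter_movedPairs_le_movedOverlap h) _)
      linarith

theorem prob_confusable_le_of_sparse (p s : I) (hp0 : 0 < (p : ℝ)) (hp1 : (p : ℝ) < 1)
    (hs0 : 0 < (s : ℝ)) (hn : 4 ≤ n) {w : ℝ}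
    (hlog : 1 ≤ Real.log n)
    (hδ : Real.log n + w ≤
      p * s ^ 2 * (1 - p * s) * (1 - √p) ^ 2 * (n - n / Real.log n))
    (hw : Real.exp (-w) ≤ 1 / 2)
    (hps : Real.log n ≤ n * (p * s ^ 2))
    (hy : Real.exp 1 * Real.log n * Real.exp (1 - Real.log n / 10) ≤ 1 / 2)
    (hp : 2 * (p : ℝ) ^ 2 * Real.exp 60 ^ 2 * n ≤ Real.log n) :
    prob (pairWeight p s) (Confusable (n := n)) ≤
      2 * Real.exp (-w) + 2 * (Real.exp 1 * Real.log n * Real.exp (1 - Real.log n / 10)) +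
        2 * (n : ℝ)⁻¹ := by
  classical
  set l := Real.log n with hl
  have hn' : (4 : ℝ) ≤ n := by exact_mod_cast hn
  have hn0 : (0 : ℝ) < n := by linarith
  have hl0 : 0 < l := by linarith
  set δ := (p * s ^ 2 * (1 - p * s) * (1 - √p) ^ 2 : ℝ) with hδdef
  have hδ0 : 0 ≤ δ := by
    have : (p : ℝ) * s ≤ 1 := mul_le_one₀ hp1.le hs0.le s.2.2
    have : 0 ≤ 1 - (p : ℝ) * s := by linarith
    positivity
  have hρ := pairWeight_nonneg p s
  have hexpl : Real.exp l = n := Real.exp_log hn0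
  have h1 : prob (pairWeight p s) (fun a b : Pairs n → Bool =>
      ∃ τ : Equiv.Perm (Fin n), τ ≠ 1 ∧ (τ.support.card : ℝ) ≤ n / l ∧
        overlap 1 a b ≤ overlap (pairPerm τ) a b) ≤ 2 * Real.exp (-w) := by
    have hx : (n : ℝ) * Real.exp (-(l + w)) = Real.exp (-w) := by
      rw [neg_add, Real.exp_add, Real.exp_neg l, hexpl]
      field_simp
    have hsum := sum_ne_one_pow_card_support_le (n := n) (Real.exp_pos (-(l + w))).le
      (by rw [hx]; exact hw)
    rw [hx] at hsum
    refine (prob_le_sum_prob hρ (Finset.univ.filter fun τ : Equiv.Perm (Fin n) =>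
        τ ≠ 1 ∧ (τ.support.card : ℝ) ≤ n / l)
      (fun τ a b => overlap 1 a b ≤ overlap (pairPerm τ) a b) ?_).trans (le_trans ?_ hsum)
    · rintro a b ⟨τ, hτ, hx, h⟩
      exact ⟨τ, by simpa using ⟨hτ, hx⟩, h⟩
    · refine (Finset.sum_le_sum fun τ hτ => ?_).trans (Finset.sum_le_sum_of_subset_of_nonneg
        (Finset.monotone_filter_right _ ?_) fun τ _ _ => by positivity)
      · have hk := (Finset.mem_filter.1 hτ).2.2
        refine (prob_overlap_one_le (pairPerm τ) p s hp0 hp1 hs0).trans ?_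
        rw [← Real.exp_nat_mul, ← hδdef]
        refine Real.exp_le_exp.2 ?_
        have h2 : (τ.support.card : ℝ) * (n - τ.support.card) ≤ (movedPairs τ).card := by
          have := mul_le_card_movedPairs τ
          have hle : τ.support.card ≤ n := by
            simpa using Finset.card_le_univ τ.support
          rw [← Nat.cast_sub hle]
          exact_mod_cast this
        have h3 : (τ.support.card : ℝ) * (n - n / l) ≤ (movedPairs τ).card :=
          le_trans (by gcongr) h2
        have h4 := mul_le_mul_of_nonneg_left h3 hδ0
        have h5 := mul_le_mul_of_nonneg_left hδ (Nat.cast_nonneg (α := ℝ) τ.support.card)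
        unfold movedPairs at h4
        linarith
      · exact fun τ _ h => h.1
  have h2 : prob (pairWeight p s) (fun a b : Pairs n → Bool =>
      ∃ S : Finset (Fin n), S.Nonempty ∧ n / l < S.card ∧
        (((incidentPairs S).filter fun e => a e = true ∧ b e = true).card : ℝ) ≤
          S.card * (l / 20 + 1)) ≤
      2 * (Real.exp 1 * l * Real.exp (1 - l / 10)) := by
    let f : ℕ → ℝ := fun k => if n / l < k then Real.exp (1 - l / 10) ^ k else 0
    have hf0 : ∀ k, 0 ≤ f k := fun k => by
      simp only [f]
      split_ifs <;> positivity
    refine (prob_le_sum_prob hρ (Finset.univ.filter fun S : Finset (Fin n) =>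
        S.Nonempty ∧ n / l < S.card)
      (fun S a b => (((incidentPairs S).filter fun e => a e = true ∧ b e = true).card : ℝ) ≤
          S.card * (l / 20 + 1)) ?_).trans (le_trans ?_
      (sum_nonempty_card_le (n := n) (f := f) (by positivity) hy fun k hk => ?_))
    · rintro a b ⟨S, hS, hx, h⟩
      exact ⟨S, by simpa using ⟨hS, hx⟩, h⟩
    · refine (Finset.sum_le_sum fun S hS => ?_).trans (Finset.sum_le_sum_of_subset_of_nonneg
        (Finset.monotone_filter_right _ ?_) fun S _ _ => hf0 _)
      · have hk := (Finset.mem_filter.1 hS).2.2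
        simp only [f, if_pos hk]
        refine (prob_card_common_le (incidentPairs S) p s _).trans ?_
        rw [← Real.exp_nat_mul]
        refine Real.exp_le_exp.2 ?_
        have h3 := mul_le_two_mul_card_incidentPairs S
        have hps0 : (0 : ℝ) ≤ p * s ^ 2 := by positivity
        have h4 := mul_le_mul_of_nonneg_left h3 hps0
        -- The Chernoff exponent per vertex is then at most `l / 20 + 1 - 3 * l / 20 = 1 - l / 10`.
        have h5 : l * (3 / 5) ≤ (p * s ^ 2) * (n - 1) := by
          have : (p * s ^ 2 : ℝ) * (n * (3 / 5)) ≤ (p * s ^ 2) * (n - 1) := by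
            gcongr
            linarith
          linarith
        have h6 := mul_le_mul_of_nonneg_left h5 (Nat.cast_nonneg (α := ℝ) S.card)
        linarith
      · exact fun S _ h => h.1
    · simp only [f]
      split_ifs with hnk
      · rw [mul_pow]
        gcongr
        refine (choose_le_exp_mul_pow hk n).trans ?_
        have hk0 : (0 : ℝ) < k := by exact_mod_cast hk
        gcongr
        -- Because `k > n / l`, the entropy factor `n / k` is at most `l`, only logarithmic in `n`.
        rw [div_lt_iff₀ hl0] at hnk
        rw [div_le_iff₀ hk0]
        linarith
      · rw [mul_zero]
        positivity
  have h3 : prob (pairWeight p s) (fun a b : Pairs n → Bool =>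
      ∃ τ : Equiv.Perm (Fin n), τ ≠ 1 ∧
        τ.support.card * (l / 20) ≤ movedOverlap (pairPerm τ) a b) ≤ 2 * (n : ℝ)⁻¹ := by
    rw [← mul_exp_neg_two_log (by omega : 1 ≤ n)]
    refine (prob_le_sum_prob hρ (Finset.univ.filter fun τ : Equiv.Perm (Fin n) => τ ≠ 1)
      (fun τ a b => τ.support.card * (l / 20) ≤ movedOverlap (pairPerm τ) a b) ?_).trans
      (le_trans (Finset.sum_le_sum fun τ _ => ?_) (sum_ne_one_pow_card_support_le
        (Real.exp_pos _).le ?_))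
    · rintro a b ⟨τ, hτ, h⟩
      exact ⟨τ, by simpa using hτ, h⟩
    · refine (prob_le_movedOverlap_le (pairPerm τ) p s hp0 hp1 hs0 (c := 60) (by norm_num)
        _).trans ?_
      rw [← Real.exp_nat_mul (-(2 * l))]
      refine Real.exp_le_exp.2 ?_
      have h4 : ((movedPairs τ).card : ℝ) ≤ τ.support.card * n := by
        exact_mod_cast card_movedPairs_le τ
      have h5 := mul_le_mul_of_nonneg_left h4
        (by positivity : 0 ≤ 2 * (p : ℝ) ^ 2 * Real.exp 60 ^ 2)
      have h6 := mul_le_mul_of_nonneg_left hp (Nat.cast_nonneg (α := ℝ) τ.support.card)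
      unfold movedPairs at h5
      linarith
    · rw [mul_exp_neg_two_log (by omega), inv_le_comm₀ (by linarith) (by norm_num)]
      linarith
  refine (prob_le_add hρ fun a b h => h.cases (n / l) (l / 20)).trans ?_
  refine (add_le_add h1 ((prob_le_add hρ fun a b h => h).trans (add_le_add h2 h3))).trans ?_
  linarith

end Confusable

/-! ## Asymptotics -/

theorem one_sub_sub_le_mul {a z r : ℝ} (hz0 : 0 ≤ z) (hz1 : z ≤ 1) (ha0 : 0 ≤ a) (haz : a ≤ z)
    (hr0 : 0 ≤ r) : 1 - 3 * z - r ≤ (1 - a) * (1 - z) ^ 2 * (1 - r) := by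
  have h1 : 1 - 3 * z ≤ (1 - a) * (1 - z) ^ 2 := by
    have h2 : 0 ≤ z ^ 2 * (3 - z) := mul_nonneg (sq_nonneg z) (by linarith)
    calc 1 - 3 * z ≤ (1 - z) * (1 - z) ^ 2 := by linarith
      _ ≤ _ := by gcongr
  have h3 : (1 - a) * (1 - z) ^ 2 ≤ 1 :=
    mul_le_one₀ (by linarith) (by positivity) (pow_le_one₀ (by linarith) (by linarith))
  have h4 := mul_le_of_le_one_left hr0 h3
  linarith

/-- The regimes are separated at `nps² = c * log n`, with `c` chosen so that the dense bound applies
above it. Below it, passing from `m = nps²` to the sparse exponent loses at most `3 * m * √p ≤ 1`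
and `m / log n ≤ c`. This explains the `- c - 1`: a bounded loss is harmless since `m - log n → ∞`.
-/
theorem prob_confusable_le {n : ℕ} (p s : I) {s₀ p₁ c : ℝ} (hn : 6 ≤ n) (hs₀ : 0 < s₀)
    (hs : s₀ ≤ s) (hp : (p : ℝ) ≤ p₁) (hp₁ : p₁ < 1)
    (hc : c * ((1 - p₁) * (1 - √p₁) ^ 2) = 8) (hlog : 1 ≤ Real.log n)
    (hω : Real.log n ≤ n * p * (s : ℝ) ^ 2)
    (hw : Real.exp (-(n * p * (s : ℝ) ^ 2 - Real.log n - c - 1)) ≤ 1 / 2)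
    (hy : Real.exp 1 * Real.log n * Real.exp (1 - Real.log n / 10) ≤ 1 / 2)
    (h₁ : 9 * c ^ 3 / s₀ ^ 2 * (Real.log n ^ 3 / n) ≤ 1)
    (h₂ : 2 * Real.exp 60 ^ 2 * c ^ 2 / s₀ ^ 4 * (Real.log n ^ 1 / n) ≤ 1) :
    prob (pairWeight p s) (Confusable (n := n)) ≤
      2 * Real.exp (-(n * p * (s : ℝ) ^ 2 - Real.log n - c - 1)) +
        2 * (Real.exp 1 * Real.log n * Real.exp (1 - Real.log n / 10)) + 2 * (n : ℝ)⁻¹ := by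
  set l := Real.log n with hl
  have hn' : (6 : ℝ) ≤ n := by exact_mod_cast hn
  have hn0 : (0 : ℝ) < n := by linarith
  have hs0 : 0 < (s : ℝ) := hs₀.trans_le hs
  have hs1 : (s : ℝ) ≤ 1 := s.2.2
  have hl0 : 0 < l := by linarith
  have hp0 : 0 < (p : ℝ) := by
    refine lt_of_le_of_ne p.2.1 fun h => ?_
    rw [← h] at hω
    simp at hω
    linarith
  have hp1 : (p : ℝ) < 1 := hp.trans_lt hp₁
  set z := √(p : ℝ) with hz
  have hz0 : 0 ≤ z := Real.sqrt_nonneg _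
  have hzp : (p : ℝ) = z ^ 2 := (Real.sq_sqrt hp0.le).symm
  have hz1 : z < 1 := by rw [hz, Real.sqrt_lt' one_pos]; simpa using hp1
  have hz₁ : √p₁ < 1 := by rw [Real.sqrt_lt' one_pos]; simpa using hp₁
  have hzz : z ≤ √p₁ := Real.sqrt_le_sqrt hp
  have hps : (p : ℝ) * s ≤ p := mul_le_of_le_one_right hp0.le hs1
  have hc1 : 0 < (1 - p₁) * (1 - √p₁) ^ 2 :=
    mul_pos (by linarith) (pow_pos (by linarith) 2)
  have hc0 : 0 < c := by
    by_contra h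
    nlinarith
  set m := (n * p * (s : ℝ) ^ 2 : ℝ) with hm
  have hm0 : 0 < m := by positivity
  have hexp := Real.exp_pos (-(m - l - c - 1))
  have hyy : 0 ≤ Real.exp 1 * l * Real.exp (1 - l / 10) := by positivity
  rcases le_or_gt (c * l) m with hcm | hcm
  · refine (prob_confusable_le_of_dense p s hp0 hp1 hs0 hn ?_).trans (by linarith)
    rw [← hz]
    calc 8 * l = (c * l) * ((1 - p₁) * (1 - √p₁) ^ 2) := by rw [← hc]; ring
      _ ≤ m * ((1 - p * s) * (1 - z) ^ 2) := by
          have : 0 ≤ 1 - p₁ := by linarith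
          have : 0 ≤ 1 - √p₁ := by linarith
          have : (p : ℝ) * s ≤ p₁ := hps.trans hp
          have : 0 ≤ 1 - (p : ℝ) * s := by linarith
          gcongr
      _ = _ := by rw [hm]; ring
  · have hpc : (p : ℝ) ≤ c * l / (n * s₀ ^ 2) := by
      rw [le_div_iff₀ (by positivity)]
      calc (p : ℝ) * (n * s₀ ^ 2) ≤ p * (n * (s : ℝ) ^ 2) := by gcongr
        _ = m := by rw [hm]; ring
        _ ≤ c * l := hcm.le
    have hzl : 3 * m * z ≤ 1 := by
      have h3 : 3 * (c * l) * z ≤ 1 := by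
        -- Squaring turns `z` into `p`, whose bound is of order `l / n`; this produces the `l ^ 3 /
        -- n` of `h₁`.
        refine (abs_le_one_iff_mul_self_le_one.2 ?_ |> (le_abs_self _).trans)
        calc 3 * (c * l) * z * (3 * (c * l) * z) = 9 * (c * l) ^ 2 * z ^ 2 := by ring
          _ ≤ 9 * (c * l) ^ 2 * (c * l / (n * s₀ ^ 2)) := by
              rw [← hzp]
              gcongr
          _ = 9 * c ^ 3 / s₀ ^ 2 * (l ^ 3 / n) := by field_simp
          _ ≤ 1 := h₁
      refine le_trans ?_ h3
      gcongr
    refine prob_confusable_le_of_sparse p s hp0 hp1 hs0 (by omega) hlog ?_ hw ?_ hy ?_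
    · rw [← hz, ← hl]
      have h4 : p * (s : ℝ) ^ 2 * (1 - p * s) * (1 - z) ^ 2 * (n - n / l) =
          m * ((1 - p * s) * (1 - z) ^ 2 * (1 - 1 / l)) := by
        rw [hm]
        field_simp
      have h8 := one_sub_sub_le_mul hz0 hz1.le (mul_nonneg hp0.le hs0.le)
        (hps.trans (by rw [hzp]; exact pow_le_of_le_one hz0 hz1.le two_ne_zero))
        (one_div_nonneg.2 hl0.le)
      have h10 : m * (1 / l) ≤ c := by
        rw [mul_one_div, div_le_iff₀ hl0]
        exact hcm.le
      rw [h4]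
      have := mul_le_mul_of_nonneg_left h8 hm0.le
      linarith
    · rw [← hl, ← mul_assoc, ← hm]
      exact hω
    · rw [← hl]
      calc 2 * (p : ℝ) ^ 2 * Real.exp 60 ^ 2 * n
          ≤ 2 * (c * l / (n * s₀ ^ 2)) ^ 2 * Real.exp 60 ^ 2 * n := by gcongr
        _ = (2 * Real.exp 60 ^ 2 * c ^ 2 / s₀ ^ 4 * (l ^ 1 / n)) * l := by field_simp
        _ ≤ l := mul_le_of_le_one_left hl0.le h₂

theorem tendsto_log_pow_div (k : ℕ) :
    Tendsto (fun n : ℕ => Real.log n ^ k / (n : ℝ)) atTop (𝓝 0) :=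
  (Real.isLittleO_pow_log_id_atTop (n := k)).tendsto_div_nhds_zero.comp tendsto_natCast_atTop_atTop

theorem tendsto_log_mul_exp_neg_log_div :
    Tendsto (fun n : ℕ => Real.exp 1 * Real.log n * Real.exp (1 - Real.log n / 10))
      atTop (𝓝 0) := by
  have hl : Tendsto (fun n : ℕ => Real.log n / 10) atTop atTop :=
    (Real.tendsto_log_atTop.comp tendsto_natCast_atTop_atTop).atTop_div_const (by norm_num)
  have h := ((Real.tendsto_pow_mul_exp_neg_atTop_nhds_zero 1).comp hl).const_mul
    (Real.exp 1 * Real.exp 1 * 10)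
  rw [mul_zero] at h
  refine h.congr fun n => ?_
  simp only [Function.comp_apply, sub_eq_add_neg, Real.exp_add]
  ring

theorem tendsto_prob_confusable {p s : ℕ → I}
    (hs : ∃ s₀ : ℝ, 0 < s₀ ∧ ∀ᶠ n in atTop, s₀ ≤ (s n : ℝ))
    (hp : ∃ p₁ : ℝ, p₁ < 1 ∧ ∀ᶠ n in atTop, (p n : ℝ) ≤ p₁)
    (h : Tendsto (fun n : ℕ => (n : ℝ) * p n * (s n : ℝ) ^ 2 - Real.log n) atTop atTop) :
    Tendsto (fun n => ENNReal.ofReal (prob (pairWeight (p n) (s n)) (Confusable (n := n))))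
      atTop (𝓝 0) := by
  obtain ⟨s₀, hs₀, hs⟩ := hs
  obtain ⟨p₁, hp₁, hp⟩ := hp
  have hz₁ : √p₁ < 1 := by rw [Real.sqrt_lt' one_pos]; simpa using hp₁
  have hc1 : 0 < (1 - p₁) * (1 - √p₁) ^ 2 :=
    mul_pos (by linarith) (pow_pos (by linarith) 2)
  obtain ⟨c, hc⟩ : ∃ c, c * ((1 - p₁) * (1 - √p₁) ^ 2) = 8 :=
    ⟨8 / _, div_mul_cancel₀ _ hc1.ne'⟩
  have hlog : Tendsto (fun n : ℕ => Real.log n) atTop atTop :=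
    Real.tendsto_log_atTop.comp tendsto_natCast_atTop_atTop
  have hw : Tendsto (fun n : ℕ =>
      Real.exp (-(n * p n * (s n : ℝ) ^ 2 - Real.log n - c - 1))) atTop (𝓝 0) := by
    refine Real.tendsto_exp_neg_atTop_nhds_zero.comp ?_
    simp_rw [sub_eq_add_neg _ c, sub_eq_add_neg _ (1 : ℝ)]
    exact tendsto_atTop_add_const_right _ _ (tendsto_atTop_add_const_right _ _ h)
  have hy := tendsto_log_mul_exp_neg_log_div
  have hβ := ((hw.const_mul 2).add (hy.const_mul 2)).add
    ((tendsto_inv_atTop_nhds_zero_nat (𝕜 := ℝ)).const_mul 2)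
  simp only [mul_zero, add_zero] at hβ
  have h₁ := (tendsto_log_pow_div 3).const_mul (9 * c ^ 3 / s₀ ^ 2)
  have h₂ := (tendsto_log_pow_div 1).const_mul (2 * Real.exp 60 ^ 2 * c ^ 2 / s₀ ^ 4)
  rw [mul_zero] at h₁ h₂
  have hβ' := ENNReal.tendsto_ofReal hβ
  rw [ENNReal.ofReal_zero] at hβ'
  refine tendsto_of_tendsto_of_tendsto_of_le_of_le' tendsto_const_nhds hβ'
    (Eventually.of_forall fun n => zero_le) ?_
  filter_upwards [hs, hp, eventually_ge_atTop 6, hlog.eventually_ge_atTop 1,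
    h.eventually_ge_atTop 0, hw.eventually_le_const (by norm_num : (0 : ℝ) < 1 / 2),
    hy.eventually_le_const (by norm_num : (0 : ℝ) < 1 / 2), h₁.eventually_le_const one_pos,
    h₂.eventually_le_const one_pos] with n a1 a2 a3 a4 a5 a6 a7 a8 a9
  exact ENNReal.ofReal_le_ofReal (prob_confusable_le (p n) (s n) a3 hs₀ a1 a2 hp₁ hc a4
    (by linarith) a6 a7 a8 a9)

theorem tendsto_toOuterMeasure_randomSubset {α : ℕ → I}
    (hα : Tendsto (fun n : ℕ => (α n : ℝ) * n) atTop atTop) :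
    Tendsto (fun n : ℕ => (randomSubset n (α n)).toOuterMeasure
        {S | (n : ℝ) ^ (2 * ((α n : ℝ) * n)) < (n : ℝ) ^ S.ncard}) atTop (𝓝 0) := by
  have h2 : 0 < 2 * Real.log 2 - 1 := by
    have := Real.log_two_gt_d9
    linarith
  have h := ENNReal.tendsto_ofReal
    (Real.tendsto_exp_neg_atTop_nhds_zero.comp (hα.const_mul_atTop h2))
  rw [ENNReal.ofReal_zero] at h
  refine tendsto_of_tendsto_of_tendsto_of_le_of_le' tendsto_const_nhds h
    (Eventually.of_forall fun n => zero_le) ?_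
  filter_upwards [eventually_ge_atTop 1] with n hn
  exact toOuterMeasure_randomSubset_pow_le hn (α n)

end GraphMatching

theorem theorem5 :
    ∃ C : ℝ, 0 < C ∧
      ∀ (p s α : ℕ → unitInterval) (A : ∀ n, GraphMatching.SeededAlg n)
        (tie : ∀ n, SimpleGraph (Fin n) → SimpleGraph (Fin n) →
          Finset (Equiv.Perm (Fin n)) → Equiv.Perm (Fin n)),
        (∀ n G₁ G₂ S, S.Nonempty → tie n G₁ G₂ S ∈ S) →
        (∃ s₀ : ℝ, 0 < s₀ ∧ ∀ᶠ n in atTop, s₀ ≤ (s n : ℝ)) →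
        (∃ p₁ : ℝ, p₁ < 1 ∧ ∀ᶠ n in atTop, (p n : ℝ) ≤ p₁) →
        Tendsto (fun n : ℕ => (n : ℝ) * p n * (s n : ℝ) ^ 2 - Real.log n) atTop atTop →
        Tendsto (fun n : ℕ => (α n : ℝ) * n) atTop atTop →
        Tendsto (fun n => GraphMatching.seededSuccess n (p n) (s n) (α n) (A n)) atTop (𝓝 1) →
        Tendsto (fun n =>
          (GraphMatching.seedlessRun n (p n) (s n) (α n) (A n) (tie n)).toOuterMeasure
            {y | y.1 = y.2.2 ∧ (y.2.1 : ℝ) ≤ (n : ℝ) ^ (C * ((α n : ℝ) * n))})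
          atTop (𝓝 1) := by
  refine ⟨2, two_pos, fun p s α A tie htie hs hp h hα hA => ?_⟩
  have h1 := GraphMatching.tendsto_prob_confusable hs hp h
  have h2 := GraphMatching.tendsto_toOuterMeasure_randomSubset hα
  -- The seedless success probability is squeezed between the seeded one minus the two error terms,
  -- and 1.
  have h3 := ENNReal.Tendsto.sub hA (h1.add h2) (Or.inl ENNReal.one_ne_top)
  rw [add_zero, tsub_zero] at h3
  refine tendsto_of_tendsto_of_tendsto_of_le_of_le h3 tendsto_const_nhds (fun n => ?_) fun n => ?_
  · refine tsub_le_iff_right.2 ((GraphMatching.seededSuccess_le n (p n) (s n) (α n) (A n) (tie n)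
      (htie n) ((n : ℝ) ^ (2 * ((α n : ℝ) * n)))).trans ?_)
    rw [add_assoc]
    gcongr
    exact GraphMatching.correlatedER_notUniqueMin_le n (p n) (s n)
  · exact (MeasureTheory.measure_mono (Set.subset_univ _)).trans_eq
      ((PMF.toOuterMeasure_apply_eq_one_iff _ _).2 (Set.subset_univ _))
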